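/- Let $d\ge 0$, $M\ge 1$, $T\ge 1$ be integers. Let $\{x_t\}_{t\ge 0}$ be the $\mathbb R^d$-valued Markov source $x_{t+1}=f(x_t,w_t)$, where $f:\mathbb R^d\times\mathbb R^d\to\mathbb R^d$ is Borel, $\{w_t\}$ is i.i.d. with law $\nu_w$ and independent of $x_0\sim\pi_0$. Assume: (a) for each $x$ the law of $f(x,w_t)$ has a density $\phi(\cdot\,|x)$ with respect to Lebesgue measure that is everywhere positive, bounded by $C$ and Lipschitz with constant $C_1$, where $C,C_1$ do not depend on $x$; (b) $\|f(x,w)\|\le K(\|x\|+\|w\|)$ for some $K>0$ and all $x,w$; (c) the reconstruction space is $\mathbb R^d$ and the cost is $\|x-u\|^2$ (Euclidean norm); (d) $\int\|z\|^2\,\nu_w(dz)<\infty$; (e) either $\pi_0$ has a density and $\int\|x\|^2\,\pi_0(dx)<\infty$, or $\pi_0=\delta_{x_0}$ is a point mass. *Policies and costs.* Let $\mathsf M=\{1,\dots,M\}$. A quantizer is a Borel map $Q:\mathbb R^d\to\mathsf M$; $\mathcal Q_c$ is the set of quantizers all of whose cells $Q^{-1}(i)$ are convex (possibly empty). A quantization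 policy $\Pi$ is a sequence of Borel maps $\eta_t:\mathsf M^t\times(\mathbb R^d)^{t+1}\to\mathsf M$, generating the messages $q_t=\eta_t(q_0,\dots,q_{t-1},x_0,\dots,x_t)$. Let $\pi_t$ be the conditional law of $x_t$ given $q_0,\dots,q_{t-1}$ (at $t=0$ this is the given $\pi_0$). The class $\Pi_W^C$ consists of the policies for which there are maps $\hat\eta_t:\mathcal P(\mathbb R^d)\to\mathcal Q_c$ such that, for every $t\ge 0$, almost surely $q_t=Q_t(x_t)$ with $Q_t=\hat\eta_t(\pi_t)$. For a receiver policy $\gamma=\{\gamma_t\}$, $\gamma_t:\mathsf M^{t+1}\to\mathbb R^d$, put $$J_{\pi_0}(\Pi,T)=\inf_\gamma E\Big[\frac1T\sum_{t=0}^{T-1}\|x_t-\gamma_t(q_0,\dots,q_t)\|^2\Big].$$ *Dynamic programming.* For a probability measure $\pi$ on $\mathbb R^d$ and $Q\in\mathcal Q_c$ let $c(\pi,Q)=\sum_{i=1}^M\inf_{u\in\mathbb R^d}\int_{Q^{-1}(i)}\|x-u\|^2\,\pi(dx)\in[0,\infty]$, and for $\pi(Q^{-1}(m))>0$ let $\hat\pi(m,\pi,Q)$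 be the law of $f(x,w)$, where $x\sim\pi(\cdot\,|\,Q^{-1}(m))$ and $w\sim\nu_w$ are independent. Put $J^T_T=0$ and, for $t=T-1,\dots,0$, $$J^T_t(\pi)=\inf_{Q\in\mathcal Q_c}\Big(\frac1T c(\pi,Q)+\sum_{m}J^T_{t+1}\big(\hat\pi(m,\pi,Q)\big)\,\pi(Q^{-1}(m))\Big),$$ the sum (over the $m$ with $\pi(Q^{-1}(m))>0$) being $E[J^T_{t+1}(\pi_{t+1})\mid\pi_t=\pi,Q_t=Q]$. Let $\mathcal S$ be the set of probability measures on $\mathbb R^d$ having a density that is bounded by $C$ and Lipschitz with constant $C_1$. **Conclusion.** 1. There is $\Pi\in\Pi_W^C$ with $J_{\pi_0}(\Pi,T)=\inf_{\Pi'\in\Pi_W^C}J_{\pi_0}(\Pi',T)$. 2. $J^T_0(\pi_0)=\min_{\Pi\in\Pi_W^C}J_{\pi_0}(\Pi,T)$, and this value is finite. 3. For all $0\le t<T$ and $\pi\in\mathcal S$, and also for $t=0$ and $\pi=\pi_0$, the infimum in the recursion for $J^T_t(\pi)$ is attained by some $Q\in\mathcal Q_c$. 4. For all $0\le t<T$: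 if $\mu_n,\pi\in\mathcal S$, $\mu_n\to\pi$ weakly and $\lim_{L\to\infty}\sup_n\int_{\{\|x\|^2\ge L\}}\|x\|^2\,\mu_n(dx)=0$, then $J^T_t(\pi)<\infty$ and $J^T_t(\mu_n)\to J^T_t(\pi)$. -/

import Mathlib

open MeasureTheory ProbabilityTheory Filter Topology
open scoped ENNReal NNReal

namespace ZeroDelay

noncomputable section

/-- The space `ℝ^d` with its Euclidean norm. -/
abbrev E (d : ℕ) : Type := EuclideanSpace ℝ (Fin d)

/-- The Markov source `x_0 = X₀`, `x_{t+1} = f (x_t, w_t)`. -/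
def source {d : ℕ} {Ω : Type*} (f : E d → E d → E d) (X₀ : Ω → E d) (W : ℕ → Ω → E d) :
    ℕ → Ω → E d
  | 0 => X₀
  | t + 1 => fun ω => f (source f X₀ W t ω) (W t ω)

/-- An `M`-cell quantizer on `ℝ^d`: a Borel map to the `M`-element message set.
Its cells are the preimages of the messages, and some may be empty. -/
abbrev Quantizer (d M : ℕ) : Type := {Q : E d → Fin M // Measurable Q}

/-- The `i`-th cell of a quantizer. -/
def cell {d M : ℕ} (Q : Quantizer d M) (i : Fin M) : Set (E d) := Q.1 ⁻¹' {i}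

/-- The quantizers all of whose cells are convex (the empty set is convex). -/
def convexQuantizers (d M : ℕ) : Set (Quantizer d M) :=
  {Q | ∀ i, Convex ℝ (cell Q i)}

/-- An admissible (zero-delay) quantization policy: at time `t` a Borel function of the past
messages `q_0, …, q_{t-1}` and of the source samples `x_0, …, x_t`. -/
structure Policy (d M : ℕ) where
  /-- the encoder at time `t` -/
  enc : (t : ℕ) → (Fin t → Fin M) × (Fin (t + 1) → E d) → Fin M
  measurable_enc : ∀ t, Measurable (enc t)

/-- The message `q_t` generated along the source path `x`. -/
def Policy.message {d M : ℕ} (η : Policy d M) (x : ℕ → E d) (t : ℕ) : Fin M :=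
  η.enc t (fun i : Fin t => η.message x i, fun i => x i)
termination_by t
decreasing_by exact i.isLt

/-- The message history `(q_0, …, q_{t-1})` as a random variable, for the source process `X`. -/
def Policy.history {d M : ℕ} {Ω : Type*} (η : Policy d M) (X : ℕ → Ω → E d) (t : ℕ) (ω : Ω) :
    Fin t → Fin M :=
  fun i => η.message (fun s => X s ω) i

/-- The random conditional law `π_t` of `x_t` given `(q_0, …, q_{t-1})`, that is, the regular
conditional distribution evaluated at the random history. At `t = 0` the history is trivial, so
this is the law of `x_0`. -/
def Policy.belief {d M : ℕ} {Ω : Type*} [MeasurableSpace Ω] (η : Policy d M) (P : Measure Ω)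
    [IsFiniteMeasure P] (X : ℕ → Ω → E d) (t : ℕ) (ω : Ω) : ProbabilityMeasure (E d) :=
  ⟨condDistrib (X t) (η.history X t) P (η.history X t ω), inferInstance⟩

/-- The admissible policies for which the quantizer used at each time `t` is a function of the
conditional law `π_t` alone, with values in the quantizers with convex cells. -/
def convexMarkovPolicies {d : ℕ} (M : ℕ) {Ω : Type*} [MeasurableSpace Ω] (P : Measure Ω)
    [IsFiniteMeasure P] (X : ℕ → Ω → E d) : Set (Policy d M) :=
  {η | ∃ sel : ℕ → ProbabilityMeasure (E d) → Quantizer d M,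
    (∀ t μ, sel t μ ∈ convexQuantizers d M) ∧
    ∀ t, ∀ᵐ ω ∂P, η.message (fun s => X s ω) t = (sel t (η.belief P X t ω)).1 (X t ω)}

/-- A receiver policy: at time `t` a function of `q_0, …, q_t` with values in `ℝ^d`
(every such function is measurable, its domain being finite and discrete). -/
abbrev Receiver (d M : ℕ) : Type := (t : ℕ) → (Fin (t + 1) → Fin M) → E d

/-- The expected average cumulative quadratic cost over the horizon `T` of a policy together with
a receiver policy, with values in `[0, ∞]`. -/
def totalCost {d M : ℕ} {Ω : Type*} [MeasurableSpace Ω] (P : Measure Ω) (X : ℕ → Ω → E d)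
    (T : ℕ) (η : Policy d M) (γ : Receiver d M) : ℝ≥0∞ :=
  ∫⁻ ω, (T : ℝ≥0∞)⁻¹ * ∑ t ∈ Finset.range T,
    ENNReal.ofReal (‖X t ω - γ t (η.history X (t + 1) ω)‖ ^ 2) ∂P

/-- The cost of a policy: the infimum over all receiver policies. -/
def policyCost {d M : ℕ} {Ω : Type*} [MeasurableSpace Ω] (P : Measure Ω) (X : ℕ → Ω → E d)
    (T : ℕ) (η : Policy d M) : ℝ≥0∞ :=
  ⨅ γ : Receiver d M, totalCost P X T η γ

/-- The one-stage cost `c(π, Q) = ∑_i inf_u ∫_{Q⁻¹(i)} ‖x - u‖² π(dx)`. -/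
def stageCost {d M : ℕ} (π : Measure (E d)) (Q : Quantizer d M) : ℝ≥0∞ :=
  ∑ i, ⨅ u : E d, ∫⁻ x in cell Q i, ENNReal.ofReal (‖x - u‖ ^ 2) ∂π

/-- The filter update: the law of `f (x, w)` for independent `x ∼ π(· | Q(x) = m)` and `w ∼ ν`.
It is the zero measure if the cell has `π`-measure zero. -/
def nextBelief {d M : ℕ} (f : E d → E d → E d) (ν : Measure (E d)) (π : Measure (E d))
    (Q : Quantizer d M) (m : Fin M) : Measure (E d) :=
  ((ProbabilityTheory.cond π (cell Q m)).prod ν).map (fun p => f p.1 p.2)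

/-- `E[V(π_{t+1}) | π_t = π, Q_t = Q]`: message `m` has probability `π(Q⁻¹(m))` and leads to the
updated law. Messages of probability zero contribute `0`. -/
def expectedNext {d M : ℕ} (f : E d → E d → E d) (ν : Measure (E d)) (V : Measure (E d) → ℝ≥0∞)
    (π : Measure (E d)) (Q : Quantizer d M) : ℝ≥0∞ :=
  ∑ m, V (nextBelief f ν π Q m) * π (cell Q m)

/-- The dynamic programming iteration with `k` stages to go, for the horizon `T`. -/
def valueToGo {d : ℕ} (M : ℕ) (f : E d → E d → E d) (ν : Measure (E d)) (T : ℕ) :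
    ℕ → Measure (E d) → ℝ≥0∞
  | 0 => fun _ => 0
  | k + 1 => fun π => ⨅ Q ∈ convexQuantizers d M,
      ((T : ℝ≥0∞)⁻¹ * stageCost π Q + expectedNext f ν (valueToGo M f ν T k) π Q)

/-- The value function `J^T_t`, for `t ≤ T`: `J^T_T = 0`, and `J^T_t(π)` is the infimum over the
convex-cell quantizers `Q` of `(1/T) c(π, Q) + E[J^T_{t+1}(π_{t+1}) | π_t = π, Q_t = Q]`. -/
def valueFn {d : ℕ} (M : ℕ) (f : E d → E d → E d) (ν : Measure (E d)) (T t : ℕ) :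
    Measure (E d) → ℝ≥0∞ :=
  valueToGo M f ν T (T - t)

/-- The probability measures on `ℝ^d` that admit a density bounded by `C` and Lipschitz with
constant `C₁`. -/
def smoothLaws (d : ℕ) (C : ℝ) (C₁ : ℝ≥0) : Set (ProbabilityMeasure (E d)) :=
  {π | ∃ g : E d → ℝ, (∀ z, 0 ≤ g z ∧ g z ≤ C) ∧ LipschitzWith C₁ g ∧
    (π : Measure (E d)) = volume.withDensity (fun z => ENNReal.ofReal (g z))}

/-- The second moment of a measure on `ℝ^d`. -/
def secondMoment {d : ℕ} (μ : Measure (E d)) : ℝ≥0∞ := ∫⁻ x, ENNReal.ofReal (‖x‖ ^ 2) ∂μ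

/-- Uniform integrability of `‖x‖²` along a sequence of laws. -/
def UnifIntegrableSq {d : ℕ} (μ : ℕ → ProbabilityMeasure (E d)) : Prop :=
  Tendsto (fun L : ℝ => ⨆ n, ∫⁻ x in {x : E d | L ≤ ‖x‖ ^ 2}, ENNReal.ofReal (‖x‖ ^ 2)
    ∂(μ n : Measure (E d))) atTop (𝓝 0)

end

end ZeroDelay

open ZeroDelay

/-!
The dynamic programming recursion is well posed because, at every stage, the bracket to be minimised
is jointly continuous in the conditional law and in the quantizer, and the convex-cell quantizers
are sequentially compact.

*Compactness.* Given a sequence of partitions of `ℝ^d` into `M` convex cells, pass to a subsequence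
along which the label of every point of a countable dense set converges, and take a pointwise
ultrafilter limit. The limit cells are convex, so their frontiers are Lebesgue-null, and every
interior point of a limit cell lies in the hull of finitely many points of the dense set: the
labels converge almost everywhere (`exists_subseq_tendsto_of_convex_fibers`). The limit is Borel
because a finite convex partition always is (`measurable_of_convex_fibers`): each cell is a finite
intersection of convex sets with convex complement.

*Continuity.* Laws are compared in the dual norm of the weighted sup-norm with weight `1 + ‖x‖²`
(`WeightedConv`). This norm controls the quadratic cost (`tendsto_dispersion`), is compatible with
almost everywhere convergent cells (`WeightedConv.restrict`), and the
filter update is Lipschitz for it, thanks to the linear growth of `f` (`RegularDynamics.weightedConv_push`). The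
value functions are positively homogeneous when extended to unnormalised measures
(`valueToGo_smul`), which removes the conditioning, and with it the exceptional role of cells of
probability zero. Induction on the number of stages then gives the continuity of the value functions
(`tendsto_valueToGo`) and the existence of optimal quantizers (`exists_optimal_quantizer`) on all
absolutely continuous measures with finite second moment. On laws with bounded, uniformly Lipschitz
densities, weak convergence and uniform integrability of `‖x‖²` imply weighted convergence, because
the densities then converge pointwise (`weightedConv_of_mem_smoothLaws`).

*Policies.* The unnormalised law of `x_t` on the event of a given message history satisfies the
filter recursion (`Policy.Follows.branchLaw_succ`), since the noise at time `t` is independent of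
the past, and the cost of a policy is the sum of the stage costs over the histories. Backward
induction bounds the cost from below by the value function, with equality if every quantizer is
optimal for the conditional law. A policy of the latter kind is obtained by computing the
conditional laws with the filter recursion inside the encoder (`beliefPolicy`).
-/

namespace ZeroDelay

/-! ### Convex partitions of a finite-dimensional space -/

section ConvexPartitions

variable {F : Type*} [NormedAddCommGroup F] [NormedSpace ℝ F] [FiniteDimensional ℝ F]
  [MeasurableSpace F] [BorelSpace F]

/-- A convex set and its convex complement cannot both have empty interior, as the frontier of a
convex set is Lebesgue-null. -/
theorem interior_nonempty_or_interior_compl_nonempty {s : Set F} (hs : Convex ℝ s)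
    (hsc : Convex ℝ sᶜ) : (interior s).Nonempty ∨ (interior sᶜ).Nonempty := by
  by_contra! h
  have key : ∀ t : Set F, Convex ℝ t → interior t = ∅ →
      (Measure.addHaar : Measure F) t = 0 := fun t ht h0 =>
    measure_mono_null (by rw [frontier, h0, Set.sdiff_empty]; exact subset_closure)
      (ht.addHaar_frontier Measure.addHaar)
  have : (Measure.addHaar : Measure F) Set.univ = 0 := by
    rw [← Set.union_compl_self s]
    exact measure_union_null (key s hs h.1) (key _ hsc h.2)
  exact (isOpen_univ.measure_pos Measure.addHaar Set.univ_nonempty).ne' this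

/-- A convex set with convex complement is Borel: off a separating hyperplane it is an open
half-space, and inside the hyperplane the dimension drops. -/
theorem measurableSet_of_convex_of_convex_compl {s : Set F} (hs : Convex ℝ s)
    (hsc : Convex ℝ sᶜ) : MeasurableSet s := by
  obtain ⟨n, hn⟩ : ∃ n, Module.finrank ℝ F = n := ⟨_, rfl⟩
  induction n using Nat.strong_induction_on generalizing F with
  | _ n ih =>
  suffices H : ∀ t : Set F, Convex ℝ t → Convex ℝ tᶜ → (interior t).Nonempty →
      MeasurableSet t by
    rcases interior_nonempty_or_interior_compl_nonempty hs hsc with h | h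
    · exact H s hs hsc h
    · exact (H sᶜ hsc (by rwa [compl_compl]) h).of_compl
  intro t ht htc hint
  rcases Set.eq_empty_or_nonempty tᶜ with h0 | ⟨b, hb⟩
  · rw [Set.compl_empty_iff.1 h0]; exact MeasurableSet.univ
  obtain ⟨g, u, hg₁, hg₂⟩ := geometric_hahn_banach_open ht.interior isOpen_interior htc
    (disjoint_compl_right.mono_left interior_subset)
  obtain ⟨a, ha⟩ := hint
  have hgt : ∀ x ∈ t, g x ≤ u := by
    intro x hx
    have hx' : x ∈ closure (interior t) := by
      rw [ht.closure_interior_eq_closure_of_nonempty_interior ⟨a, ha⟩]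
      exact subset_closure hx
    exact closure_minimal (t := {y | g y ≤ u}) (fun y hy => (hg₁ y hy).le)
      (isClosed_le g.continuous continuous_const) hx'
  have hgab : g a < g b := (hg₁ a ha).trans_le (hg₂ b hb)
  obtain ⟨x₀, hx₀⟩ : ∃ x₀, g x₀ = u := by
    have hne : g (b - a) ≠ 0 := by rw [map_sub]; exact (sub_pos.2 hgab).ne'
    exact ⟨(u / g (b - a)) • (b - a), by rw [map_smul, smul_eq_mul, div_mul_cancel₀ _ hne]⟩
  let V : Submodule ℝ F := LinearMap.ker (g : F →ₗ[ℝ] ℝ)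
  have hV : Module.finrank ℝ V < n := by
    rw [← hn]
    refine Submodule.finrank_lt fun htop => ?_
    have h1 : ∀ x, g x = 0 := fun x => by
      have : x ∈ V := htop ▸ Submodule.mem_top
      simpa [V] using this
    rw [h1, h1] at hgab
    exact lt_irrefl _ hgab
  let j : V →ᵃ[ℝ] F := V.subtype.toAffineMap + AffineMap.const ℝ V x₀
  have hj : ∀ v : V, j v = (v : F) + x₀ := fun v => rfl
  have hjm : MeasurableEmbedding j := by
    have : (j : V → F) = (fun y => y + x₀) ∘ (Subtype.val) := by
      funext v; exact hj v
    rw [this]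
    exact (measurableEmbedding_addRight x₀).comp
      (MeasurableEmbedding.subtype_coe V.closed_of_finiteDimensional.measurableSet)
  have hpre : MeasurableSet (j ⁻¹' t) :=
    ih _ hV (ht.affine_preimage j) (by rw [← Set.preimage_compl]; exact htc.affine_preimage j) rfl
  have hrange : Set.range j = {x | g x = u} := by
    ext x
    constructor
    · rintro ⟨v, rfl⟩
      have : g (v : F) = 0 := v.2
      simp [hj, this, hx₀]
    · intro hx
      refine ⟨⟨x - x₀, ?_⟩, by simp [hj]⟩
      have hx' : g x = u := hx
      simp [V, hx', hx₀]
  have hdecomp : t = {x | g x < u} ∪ (j '' (j ⁻¹' t)) := by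
    rw [Set.image_preimage_eq_inter_range, hrange]
    ext x
    constructor
    · intro hx
      rcases (hgt x hx).lt_or_eq with h | h
      · exact Or.inl h
      · exact Or.inr ⟨hx, h⟩
    · rintro (h | h)
      · by_contra hx
        exact absurd (hg₂ x hx) (not_le.2 h)
      · exact h.1
  rw [hdecomp]
  exact (isOpen_lt g.continuous continuous_const).measurableSet.union
    (hjm.measurableSet_image.2 hpre)

/-- A finite partition into convex sets consists of Borel sets: by Stone's separation theorem each
cell is a finite intersection of convex sets with convex complements. -/
theorem measurable_of_convex_fibers {M : ℕ} {Q : F → Fin M}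
    (hQ : ∀ i, Convex ℝ (Q ⁻¹' {i})) : Measurable Q := by
  refine measurable_to_countable' fun i => ?_
  have hsep : ∀ j : {j : Fin M // j ≠ i}, ∃ C : Set F, Convex ℝ C ∧ Convex ℝ Cᶜ ∧
      Q ⁻¹' {i} ⊆ C ∧ Q ⁻¹' {j.1} ⊆ Cᶜ := fun j =>
    exists_convex_convex_compl_subset (hQ i) (hQ j.1)
      ((Set.disjoint_singleton.2 j.2.symm).preimage Q)
  choose C hC₁ hC₂ hC₃ hC₄ using hsep
  have : Q ⁻¹' {i} = ⋂ j, C j := by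
    refine Set.Subset.antisymm (Set.subset_iInter hC₃) fun x hx => ?_
    by_contra hne
    exact hC₄ ⟨Q x, hne⟩ rfl (Set.mem_iInter.1 hx _)
  rw [this]
  exact MeasurableSet.iInter fun j => measurableSet_of_convex_of_convex_compl (hC₁ j) (hC₂ j)

/-- Interior points of a convex set lie in the convex hull of the points of any dense set in it. -/
theorem interior_subset_convexHull_inter {s D : Set F} (hD : Dense D) :
    interior s ⊆ convexHull ℝ (interior s ∩ D) := by
  intro x hx
  set S := convexHull ℝ (interior s ∩ D) with hS
  have hSc : Convex ℝ S := convex_convexHull ℝ _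
  have hcl : interior s ⊆ closure S :=
    (hD.open_subset_closure_inter isOpen_interior).trans (closure_mono (subset_convexHull ℝ _))
  have hne : (interior S).Nonempty := by
    by_contra! h0
    have h1 : (Measure.addHaar : Measure F) (closure S) = 0 := by
      have := hSc.addHaar_frontier (Measure.addHaar : Measure F)
      rwa [frontier, h0, Set.sdiff_empty] at this
    exact (isOpen_interior.measure_pos Measure.addHaar ⟨x, hx⟩).ne' (measure_mono_null hcl h1)
  have hx' : x ∈ interior (closure S) := interior_maximal hcl isOpen_interior hx
  rw [hSc.interior_closure_eq_interior_of_nonempty_interior hne] at hx'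
  exact interior_subset hx'

/-- Sequential compactness of the convex partitions with `M` cells. Along a subsequence the labels
of a countable dense set of points converge; a pointwise ultrafilter limit labels all the points
and keeps the cells convex, and an interior point of a limit cell lies in the hull of finitely many
points of the dense set, so that its label converges too. -/
theorem exists_subseq_tendsto_of_convex_fibers {M : ℕ} (μ : Measure F) [μ.IsAddHaarMeasure]
    (Q : ℕ → F → Fin M) (hQ : ∀ n i, Convex ℝ (Q n ⁻¹' {i})) :
    ∃ (φ : ℕ → ℕ) (Q' : F → Fin M), StrictMono φ ∧ (∀ i, Convex ℝ (Q' ⁻¹' {i})) ∧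
      ∀ᵐ x ∂μ, ∀ᶠ n in atTop, Q (φ n) x = Q' x := by
  obtain ⟨D, hDc, hDd⟩ := TopologicalSpace.exists_countable_dense F
  have : Countable D := hDc
  obtain ⟨a, φ, hφ, ha⟩ := CompactSpace.tendsto_subseq (fun n => fun x : D => Q n x)
  have hD : ∀ x : D, ∀ᶠ n in atTop, Q (φ n) x = a x := fun x => by
    have h1 := (tendsto_pi_nhds.1 ha) x
    rw [nhds_discrete, tendsto_pure] at h1
    exact h1
  let U : Ultrafilter ℕ := hyperfilter ℕ
  have hU : (U : Filter ℕ) ≤ atTop := Nat.hyperfilter_le_atTop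
  have hlim : ∀ x, ∃ i, ∀ᶠ n in (U : Filter ℕ), Q (φ n) x = i := fun x =>
    Ultrafilter.eventually_exists_iff.1 (Eventually.of_forall fun n => ⟨Q (φ n) x, rfl⟩)
  choose Q' hQ' using hlim
  have hmem : ∀ x i, (∀ᶠ n in (U : Filter ℕ), Q (φ n) x = i) → Q' x = i := fun x i h => by
    obtain ⟨n, h1, h2⟩ := (h.and (hQ' x)).exists
    exact h2.symm.trans h1
  have hconv : ∀ i, Convex ℝ (Q' ⁻¹' {i}) := by
    intro i x hx y hy r t hr ht hrt
    refine hmem _ _ ?_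
    filter_upwards [hQ' x, hQ' y] with n hn₁ hn₂
    exact hQ (φ n) i (show Q (φ n) x = i from hn₁.trans hx)
      (show Q (φ n) y = i from hn₂.trans hy) hr ht hrt
  refine ⟨φ, Q', hφ, hconv, ?_⟩
  have hnull : ∀ᵐ x ∂μ, ∀ i, x ∉ frontier (Q' ⁻¹' {i}) :=
    ae_all_iff.2 fun i => measure_eq_zero_iff_ae_notMem.1 ((hconv i).addHaar_frontier μ)
  filter_upwards [hnull] with x hx
  have hxint : x ∈ interior (Q' ⁻¹' {Q' x}) := by
    by_contra h
    exact hx (Q' x) ⟨subset_closure rfl, h⟩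
  have hxh := interior_subset_convexHull_inter hDd hxint
  rw [convexHull_eq_union_convexHull_finite_subsets] at hxh
  simp only [Set.mem_iUnion] at hxh
  obtain ⟨t, ht, hxt⟩ := hxh
  have hev : ∀ᶠ n in atTop, ∀ y ∈ t, Q (φ n) y = Q' x := by
    rw [Filter.eventually_all_finset]
    intro y hy
    have hyD := hD ⟨y, (ht hy).2⟩
    have hya : Q' y = a ⟨y, (ht hy).2⟩ := hmem _ _ (hU hyD)
    have hyx : y ∈ Q' ⁻¹' {Q' x} := interior_subset (ht hy).1
    filter_upwards [hyD] with n hn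
    exact hn.trans (hya.symm.trans hyx)
  filter_upwards [hev] with n hn
  exact convexHull_min (fun y hy => hn y hy) (hQ (φ n) (Q' x)) hxt

end ConvexPartitions

/-! ### Weighted convergence of measures -/

section WeightedConvergence

variable {d : ℕ}

/-- Finite measures on `ℝ^d` with finite second moment. -/
structure HasFiniteMoments (μ : Measure (E d)) : Prop where
  isFiniteMeasure : IsFiniteMeasure μ
  secondMoment_lt_top : secondMoment μ < ∞

theorem HasFiniteMoments.mono {μ κ : Measure (E d)} (hμ : HasFiniteMoments μ) (h : κ ≤ μ) :
    HasFiniteMoments κ :=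
  have := hμ.isFiniteMeasure
  ⟨isFiniteMeasure_of_le μ h, (lintegral_mono' h le_rfl).trans_lt hμ.secondMoment_lt_top⟩

theorem HasFiniteMoments.restrict {μ : Measure (E d)} (hμ : HasFiniteMoments μ) (s : Set (E d)) :
    HasFiniteMoments (μ.restrict s) :=
  hμ.mono Measure.restrict_le_self

theorem HasFiniteMoments.smul {μ : Measure (E d)} (hμ : HasFiniteMoments μ) {c : ℝ≥0∞}
    (hc : c ≠ ∞) : HasFiniteMoments (c • μ) :=
  have := hμ.isFiniteMeasure
  ⟨μ.smul_finite hc, by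
    rw [secondMoment, lintegral_smul_measure]
    exact ENNReal.mul_lt_top hc.lt_top hμ.secondMoment_lt_top⟩

theorem HasFiniteMoments.integrable_weight {μ : Measure (E d)} (hμ : HasFiniteMoments μ) :
    Integrable (fun x => 1 + ‖x‖ ^ 2) μ := by
  have := hμ.isFiniteMeasure
  refine (integrable_const 1).add ⟨by fun_prop, ?_⟩
  rw [hasFiniteIntegral_iff_ofReal (Eventually.of_forall fun x => by positivity)]
  exact hμ.secondMoment_lt_top

theorem HasFiniteMoments.integrable {μ : Measure (E d)} (hμ : HasFiniteMoments μ) {ψ : E d → ℝ}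
    (hψ : Measurable ψ) {c : ℝ} (hle : ∀ x, |ψ x| ≤ c * (1 + ‖x‖ ^ 2)) : Integrable ψ μ :=
  (hμ.integrable_weight.const_mul c).mono' hψ.aestronglyMeasurable (Eventually.of_forall hle)

/-- Convergence in the dual norm of the weighted sup-norm with weight `1 + ‖x‖²`: integrals
converge uniformly over the measurable integrands dominated by the weight. -/
def WeightedConv (μ : ℕ → Measure (E d)) (π : Measure (E d)) : Prop :=
  ∃ ε : ℕ → ℝ, Tendsto ε atTop (𝓝 0) ∧ ∀ n (ψ : E d → ℝ), Measurable ψ →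
    (∀ x, |ψ x| ≤ 1 + ‖x‖ ^ 2) → |∫ x, ψ x ∂μ n - ∫ x, ψ x ∂π| ≤ ε n

theorem WeightedConv.const (π : Measure (E d)) : WeightedConv (fun _ => π) π :=
  ⟨fun _ => 0, tendsto_const_nhds, fun n ψ _ _ => by simp⟩

theorem WeightedConv.comp {μ : ℕ → Measure (E d)} {π : Measure (E d)} (h : WeightedConv μ π)
    {φ : ℕ → ℕ} (hφ : Tendsto φ atTop atTop) : WeightedConv (fun n => μ (φ n)) π := by
  obtain ⟨ε, hε, H⟩ := h
  exact ⟨fun n => ε (φ n), hε.comp hφ, fun n ψ h₁ h₂ => H (φ n) ψ h₁ h₂⟩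

theorem abs_integral_sub_le_of_weight {μ π : Measure (E d)} {ε : ℝ}
    (H : ∀ ψ : E d → ℝ, Measurable ψ → (∀ x, |ψ x| ≤ 1 + ‖x‖ ^ 2) →
      |∫ x, ψ x ∂μ - ∫ x, ψ x ∂π| ≤ ε)
    {ψ : E d → ℝ} (hψ : Measurable ψ) {c : ℝ} (hc : 0 < c)
    (hle : ∀ x, |ψ x| ≤ c * (1 + ‖x‖ ^ 2)) :
    |∫ x, ψ x ∂μ - ∫ x, ψ x ∂π| ≤ c * ε := by
  have h := H (fun x => c⁻¹ * ψ x) (hψ.const_mul _) fun x => by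
    rw [abs_mul, abs_of_pos (inv_pos.2 hc), inv_mul_le_iff₀ hc]; exact hle x
  rwa [integral_const_mul, integral_const_mul, ← mul_sub, abs_mul, abs_of_pos (inv_pos.2 hc),
    inv_mul_le_iff₀ hc] at h

theorem WeightedConv.tendsto_integral {μ : ℕ → Measure (E d)} {π : Measure (E d)}
    (h : WeightedConv μ π) {ψ : E d → ℝ} (hψ : Measurable ψ) {c : ℝ} (hc : 0 < c)
    (hle : ∀ x, |ψ x| ≤ c * (1 + ‖x‖ ^ 2)) :
    Tendsto (fun n => ∫ x, ψ x ∂μ n) atTop (𝓝 (∫ x, ψ x ∂π)) := by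
  obtain ⟨ε, hε, H⟩ := h
  rw [tendsto_iff_dist_tendsto_zero]
  refine squeeze_zero (fun _ => dist_nonneg)
    (fun n => abs_integral_sub_le_of_weight (H n) hψ hc hle) ?_
  simpa using hε.const_mul c

/-- Restricting to sets whose indicators converge almost everywhere for the limit measure
preserves weighted convergence. -/
theorem WeightedConv.restrict {μ : ℕ → Measure (E d)} {π : Measure (E d)}
    (h : WeightedConv μ π) (hπ : HasFiniteMoments π)
    {B : ℕ → Set (E d)} {B' : Set (E d)} (hB : ∀ n, MeasurableSet (B n)) (hB' : MeasurableSet B')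
    (hBB : ∀ᵐ x ∂π, ∀ᶠ n in atTop, (x ∈ B n ↔ x ∈ B')) :
    WeightedConv (fun n => (μ n).restrict (B n)) (π.restrict B') := by
  obtain ⟨ε, hε, H⟩ := h
  let δ : ℕ → E d → ℝ := fun n x =>
    |(B n).indicator (fun _ => (1 : ℝ)) x - B'.indicator (fun _ => (1 : ℝ)) x| * (1 + ‖x‖ ^ 2)
  have hδm : ∀ n, Measurable (δ n) := fun n =>
    (((measurable_const.indicator (hB n)).sub (measurable_const.indicator hB')).abs).mul
      (by fun_prop)
  have hδle : ∀ n x, |δ n x| ≤ 1 * (1 + ‖x‖ ^ 2) := by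
    intro n x
    have h1 : |(B n).indicator (fun _ => (1 : ℝ)) x - B'.indicator (fun _ => (1 : ℝ)) x| ≤ 1 := by
      by_cases h₁ : x ∈ B n <;> by_cases h₂ : x ∈ B' <;> simp [h₁, h₂]
    have h2 : (0 : ℝ) ≤ 1 + ‖x‖ ^ 2 := by positivity
    rw [abs_mul, abs_abs, abs_of_nonneg h2]
    exact mul_le_mul_of_nonneg_right h1 h2
  have hδint : ∀ n, Integrable (δ n) π := fun n => hπ.integrable (hδm n) (hδle n)
  have hδlim : Tendsto (fun n => ∫ x, δ n x ∂π) atTop (𝓝 0) := by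
    have := tendsto_integral_of_dominated_convergence (μ := π) (F := δ) (f := fun _ => (0 : ℝ))
      (fun x => 1 * (1 + ‖x‖ ^ 2)) (fun n => (hδm n).aestronglyMeasurable)
      (hπ.integrable_weight.const_mul 1) (fun n => Eventually.of_forall (hδle n)) (by
        filter_upwards [hBB] with x hx
        refine tendsto_const_nhds.congr' ?_
        filter_upwards [hx] with n hn
        by_cases h₂ : x ∈ B'
        · simp [δ, hn.2 h₂, h₂]
        · simp [δ, mt hn.1 h₂, h₂])
    simpa using this
  refine ⟨fun n => ε n + ∫ x, δ n x ∂π, by simpa using hε.add hδlim, fun n ψ hψ hle => ?_⟩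
  have hind : ∀ s : Set (E d), ∀ x, |s.indicator ψ x| ≤ 1 + ‖x‖ ^ 2 := fun s x => by
    by_cases hx : x ∈ s
    · simpa [hx] using hle x
    · simp only [hx, not_false_iff, Set.indicator_of_notMem, abs_zero]; positivity
  have hint : ∀ s : Set (E d), MeasurableSet s → Integrable (s.indicator ψ) π := fun s hs =>
    hπ.integrable (hψ.indicator hs) (c := 1) fun x => by simpa using hind s x
  rw [← integral_indicator (hB n), ← integral_indicator hB']
  have h1 := H n ((B n).indicator ψ) (hψ.indicator (hB n)) (hind _)
  have h2 : |∫ x, (B n).indicator ψ x ∂π - ∫ x, B'.indicator ψ x ∂π| ≤ ∫ x, δ n x ∂π := by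
    rw [← integral_sub (hint _ (hB n)) (hint _ hB')]
    refine abs_integral_le_integral_abs.trans (integral_mono
      ((hint _ (hB n)).sub (hint _ hB')).abs (hδint n) fun x => ?_)
    have h3 : (B n).indicator ψ x - B'.indicator ψ x
        = ((B n).indicator (fun _ => (1 : ℝ)) x - B'.indicator (fun _ => (1 : ℝ)) x) * ψ x := by
      by_cases h₁ : x ∈ B n <;> by_cases h₂ : x ∈ B' <;> simp [h₁, h₂]
    simp only [h3, abs_mul, δ]
    exact mul_le_mul_of_nonneg_left (hle x) (abs_nonneg _)
  exact (abs_sub_le _ _ _).trans (add_le_add h1 h2)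

end WeightedConvergence

/-! ### The quadratic dispersion of a measure -/

section Dispersion

variable {d : ℕ}

/-- The least mean squared deviation of a (not necessarily normalised) measure from a point. -/
noncomputable def dispersion (κ : Measure (E d)) : ℝ≥0∞ :=
  ⨅ u : E d, ∫⁻ x, ENNReal.ofReal (‖x - u‖ ^ 2) ∂κ

theorem stageCost_eq_sum_dispersion {M : ℕ} (π : Measure (E d)) (Q : Quantizer d M) :
    stageCost π Q = ∑ i, dispersion (π.restrict (cell Q i)) := rfl

theorem abs_coord_le_weight (k : Fin d) (x : E d) : |x k| ≤ 1 * (1 + ‖x‖ ^ 2) := by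
  have h := PiLp.norm_apply_le x k
  rw [Real.norm_eq_abs] at h
  nlinarith [sq_nonneg (‖x‖ - 1)]

theorem sq_norm_le_weight (x : E d) : |‖x‖ ^ 2| ≤ 1 * (1 + ‖x‖ ^ 2) := by
  rw [abs_of_nonneg (by positivity)]; linarith

theorem dispersion_le (κ : Measure (E d)) : dispersion κ ≤ secondMoment κ :=
  (iInf_le _ 0).trans_eq (by simp [secondMoment])

theorem lintegral_sq_norm_sub {κ : Measure (E d)} (hκ : HasFiniteMoments κ) (u : E d) :
    ∫⁻ x, ENNReal.ofReal (‖x - u‖ ^ 2) ∂κ = ENNReal.ofReal (∫ x, ‖x‖ ^ 2 ∂κ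
      - 2 * ∑ k, u k * (∫ x, x k ∂κ) + κ.real Set.univ * ∑ k, u k ^ 2) := by
  have := hκ.isFiniteMeasure
  have hexp : ∀ x : E d, ‖x - u‖ ^ 2 = ‖x‖ ^ 2 - 2 * ∑ k, u k * x k + ∑ k, u k ^ 2 := by
    intro x
    simp only [EuclideanSpace.norm_sq_eq, Real.norm_eq_abs, sq_abs, PiLp.sub_apply,
      Finset.mul_sum, ← Finset.sum_sub_distrib, ← Finset.sum_add_distrib]
    exact Finset.sum_congr rfl fun k _ => by ring
  have h2 : Integrable (fun x : E d => ‖x‖ ^ 2) κ :=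
    hκ.integrable (by fun_prop) sq_norm_le_weight
  have h1 : ∀ k, Integrable (fun x : E d => u k * x k) κ := fun k =>
    (hκ.integrable (by fun_prop) (abs_coord_le_weight k)).const_mul _
  have h1' : Integrable (fun x : E d => 2 * ∑ k, u k * x k) κ :=
    (integrable_finsetSum _ fun k _ => h1 k).const_mul 2
  have h3 : Integrable (fun x : E d => ‖x - u‖ ^ 2) κ := by
    simp only [hexp]
    exact (h2.sub h1').add (integrable_const _)
  rw [← ofReal_integral_eq_lintegral_ofReal h3 (Eventually.of_forall fun x => by positivity)]
  congr 1
  simp only [hexp]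
  have e1 := integral_add (h2.sub h1') (integrable_const (μ := κ) (∑ k, u k ^ 2))
  have e2 := integral_sub h2 h1'
  simp only [Pi.sub_apply] at e1
  rw [e1, e2, integral_const_mul, integral_finsetSum _ fun k _ => h1 k, integral_const,
    smul_eq_mul]
  simp only [integral_const_mul]

/-- The dispersion is attained at the barycentre. If `κ = 0`, the quotient is a division by zero,
and both sides vanish. -/
theorem dispersion_eq {κ : Measure (E d)} (hκ : HasFiniteMoments κ) :
    dispersion κ = ENNReal.ofReal (∫ x, ‖x‖ ^ 2 ∂κ
      - (∑ k, (∫ x, x k ∂κ) ^ 2) / κ.real Set.univ) := by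
  have := hκ.isFiniteMeasure
  simp only [dispersion, lintegral_sq_norm_sub hκ]
  set m := κ.real Set.univ
  rcases (measureReal_nonneg : 0 ≤ m).eq_or_lt with h0 | hpos
  · have hκ0 : κ = 0 := Measure.measure_univ_eq_zero.1
      ((measureReal_eq_zero_iff).1 h0.symm)
    have hm : m = 0 := h0.symm
    rw [hm]
    simp [hκ0]
  refine le_antisymm ?_ (le_iInf fun u => ENNReal.ofReal_le_ofReal ?_)
  · refine iInf_le_of_le (WithLp.toLp 2 fun k => (∫ x, x k ∂κ) / m)
      (ENNReal.ofReal_le_ofReal (le_of_eq ?_))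
    simp only [Finset.mul_sum, Finset.sum_div, sub_add, ← Finset.sum_sub_distrib]
    congr 1
    refine Finset.sum_congr rfl fun k _ => ?_
    field_simp
    ring
  · simp only [Finset.mul_sum, Finset.sum_div, sub_add, ← Finset.sum_sub_distrib]
    refine sub_le_sub_left (Finset.sum_le_sum fun k _ => ?_) _
    rw [le_div_iff₀ hpos]
    nlinarith [sq_nonneg (u k * m - ∫ x, x k ∂κ)]

theorem tendsto_dispersion {κ : ℕ → Measure (E d)} {κ' : Measure (E d)} (h : WeightedConv κ κ')
    (hκ : ∀ n, HasFiniteMoments (κ n)) (hκ' : HasFiniteMoments κ') :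
    Tendsto (fun n => dispersion (κ n)) atTop (𝓝 (dispersion κ')) := by
  have := hκ'.isFiniteMeasure
  have h2 : Tendsto (fun n => ∫ x, ‖x‖ ^ 2 ∂κ n) atTop (𝓝 (∫ x, ‖x‖ ^ 2 ∂κ')) :=
    h.tendsto_integral (by fun_prop) one_pos sq_norm_le_weight
  have h1 : ∀ k, Tendsto (fun n => ∫ x, x k ∂κ n) atTop (𝓝 (∫ x, x k ∂κ')) := fun k =>
    h.tendsto_integral (by fun_prop) one_pos (abs_coord_le_weight k)
  have h0 : Tendsto (fun n => (κ n).real Set.univ) atTop (𝓝 (κ'.real Set.univ)) := by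
    have := h.tendsto_integral (ψ := fun _ => 1) measurable_const one_pos
      (fun x => by rw [abs_one, one_mul]; nlinarith [sq_nonneg ‖x‖])
    simpa using this
  rcases eq_or_ne (κ'.real Set.univ) 0 with hz | hne
  · have hκ0 : κ' = 0 := Measure.measure_univ_eq_zero.1 ((measureReal_eq_zero_iff).1 hz)
    have hd0 : dispersion κ' = 0 := by simp [dispersion, hκ0]
    have hle : ∀ n, dispersion (κ n) ≤ ENNReal.ofReal (∫ x, ‖x‖ ^ 2 ∂κ n) := fun n => by
      have := (hκ n).isFiniteMeasure
      rw [dispersion_eq (hκ n)]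
      exact ENNReal.ofReal_le_ofReal (sub_le_self _ (by positivity))
    rw [hd0]
    refine tendsto_of_tendsto_of_tendsto_of_le_of_le tendsto_const_nhds
      (h := fun n => ENNReal.ofReal (∫ x, ‖x‖ ^ 2 ∂κ n)) ?_ (fun _ => zero_le) hle
    simpa [hκ0] using ENNReal.tendsto_ofReal h2
  · rw [dispersion_eq hκ']
    simp only [dispersion_eq (hκ _)]
    exact ENNReal.tendsto_ofReal
      (h2.sub ((tendsto_finsetSum _ fun k _ => (h1 k).pow 2).div h0 hne))

theorem dispersion_smul (κ : Measure (E d)) {c : ℝ≥0∞} (hc : c ≠ ∞) :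
    dispersion (c • κ) = c * dispersion κ := by
  simp only [dispersion, lintegral_smul_measure, smul_eq_mul]
  exact (ENNReal.mul_iInf fun h => absurd h hc).symm

/-- A finite measure with infinite second moment has infinite dispersion. -/
theorem dispersion_eq_top {κ : Measure (E d)} [IsFiniteMeasure κ] (h : secondMoment κ = ∞) :
    dispersion κ = ∞ := by
  refine iInf_eq_top.2 fun u => ?_
  by_contra hne
  have hle : secondMoment κ ≤ ∫⁻ x, (ENNReal.ofReal 2 * ENNReal.ofReal (‖x - u‖ ^ 2)
      + ENNReal.ofReal 2 * ENNReal.ofReal (‖u‖ ^ 2)) ∂κ := by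
    refine lintegral_mono fun x => ?_
    rw [← ENNReal.ofReal_mul (by norm_num),
      ← ENNReal.ofReal_mul (by norm_num), ← ENNReal.ofReal_add (by positivity) (by positivity)]
    refine ENNReal.ofReal_le_ofReal ?_
    have h1 : ‖x‖ ≤ ‖x - u‖ + ‖u‖ := by simpa using norm_add_le (x - u) u
    nlinarith [sq_nonneg (‖x - u‖ - ‖u‖), norm_nonneg x]
  rw [h, lintegral_add_right _ measurable_const, lintegral_const_mul _ (by fun_prop),
    lintegral_const] at hle
  refine absurd hle (not_le.2 (ENNReal.add_lt_top.2 ⟨ENNReal.mul_lt_top (by simp)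
    (lt_top_iff_ne_top.2 hne), ENNReal.mul_lt_top
      (ENNReal.mul_lt_top (by simp) ENNReal.ofReal_lt_top) (measure_lt_top _ _)⟩))

end Dispersion

/-! ### The unnormalised filter update -/

section Push

variable {d : ℕ} {f : E d → E d → E d} {ν : Measure (E d)}

/-- The law of `f (x, w)` when `x` has the (not necessarily normalised) law `κ` and `w` is
independent of `x` with law `ν`. -/
noncomputable def push (f : E d → E d → E d) (ν κ : Measure (E d)) : Measure (E d) :=
  (κ.prod ν).map fun p => f p.1 p.2

/-- The standing hypotheses on the dynamics: `f` is Borel and of linear growth, the noise is square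
integrable, and the transition probabilities are absolutely continuous. -/
structure RegularDynamics (f : E d → E d → E d) (ν : Measure (E d)) : Prop where
  measurable : Measurable (Function.uncurry f)
  growth : ∃ K : ℝ, 0 < K ∧ ∀ x w, ‖f x w‖ ≤ K * (‖x‖ + ‖w‖)
  isProbabilityMeasure : IsProbabilityMeasure ν
  secondMoment_lt_top : secondMoment ν < ∞
  absolutelyContinuous : ∀ x, ν.map (f x) ≪ volume

theorem nextBelief_eq_push {M : ℕ} (π : Measure (E d)) (Q : Quantizer d M) (m : Fin M) :
    nextBelief f ν π Q m = push f ν (ProbabilityTheory.cond π (cell Q m)) := rfl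

theorem push_smul [SFinite ν] (κ : Measure (E d)) (c : ℝ≥0∞) : push f ν (c • κ) = c • push f ν κ := by
  rw [push, Measure.prod_smul_left, Measure.map_smul, push]

theorem RegularDynamics.hasFiniteMoments (h : RegularDynamics f ν) : HasFiniteMoments ν :=
  have := h.isProbabilityMeasure
  ⟨inferInstance, h.secondMoment_lt_top⟩

theorem RegularDynamics.hasFiniteMoments_push (h : RegularDynamics f ν) {κ : Measure (E d)}
    (hκ : HasFiniteMoments κ) : HasFiniteMoments (push f ν κ) := by
  have := h.isProbabilityMeasure
  have := hκ.isFiniteMeasure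
  obtain ⟨K, hK, hg⟩ := h.growth
  refine ⟨by unfold push; infer_instance, ?_⟩
  have hm : Measurable fun p : E d × E d => f p.1 p.2 := h.measurable
  rw [secondMoment, push, lintegral_map (by fun_prop) hm]
  have hle : ∀ p : E d × E d, ENNReal.ofReal (‖f p.1 p.2‖ ^ 2) ≤
      ENNReal.ofReal (2 * K ^ 2) * (ENNReal.ofReal (‖p.1‖ ^ 2) + ENNReal.ofReal (‖p.2‖ ^ 2)) := by
    intro p
    rw [← ENNReal.ofReal_add (by positivity) (by positivity), ← ENNReal.ofReal_mul (by positivity)]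
    refine ENNReal.ofReal_le_ofReal ?_
    calc ‖f p.1 p.2‖ ^ 2 ≤ (K * (‖p.1‖ + ‖p.2‖)) ^ 2 :=
          pow_le_pow_left₀ (norm_nonneg _) (hg _ _) 2
      _ ≤ 2 * K ^ 2 * (‖p.1‖ ^ 2 + ‖p.2‖ ^ 2) := by
          nlinarith [mul_nonneg (sq_nonneg K) (sq_nonneg (‖p.1‖ - ‖p.2‖))]
  refine (lintegral_mono hle).trans_lt ?_
  rw [lintegral_const_mul _ (by fun_prop), lintegral_prod _ (by fun_prop)]
  refine ENNReal.mul_lt_top ENNReal.ofReal_lt_top ?_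
  simp only [lintegral_add_left measurable_const, lintegral_const, measure_univ, mul_one]
  rw [lintegral_add_right _ measurable_const, lintegral_const]
  exact ENNReal.add_lt_top.2 ⟨hκ.secondMoment_lt_top,
    ENNReal.mul_lt_top h.secondMoment_lt_top (measure_lt_top _ _)⟩

theorem RegularDynamics.push_absolutelyContinuous (h : RegularDynamics f ν) (κ : Measure (E d))
    [SFinite κ] : push f ν κ ≪ volume := by
  have := h.isProbabilityMeasure
  have hm : Measurable fun p : E d × E d => f p.1 p.2 := h.measurable
  refine Measure.AbsolutelyContinuous.mk fun s hs h0 => ?_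
  rw [push, Measure.map_apply hm hs, Measure.prod_apply (hm hs)]
  refine (lintegral_congr fun x => ?_).trans lintegral_zero
  have hx := h.absolutelyContinuous x h0
  have hfx : Measurable (f x) := hm.comp measurable_prodMk_left
  rwa [Measure.map_apply hfx hs] at hx

theorem RegularDynamics.integral_push (h : RegularDynamics f ν) {κ : Measure (E d)}
    (hκ : HasFiniteMoments κ) {ψ : E d → ℝ} (hψ : Measurable ψ)
    (hle : ∀ x, |ψ x| ≤ 1 + ‖x‖ ^ 2) :
    ∫ y, ψ y ∂push f ν κ = ∫ x, ∫ w, ψ (f x w) ∂ν ∂κ := by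
  have := h.isProbabilityMeasure
  have := hκ.isFiniteMeasure
  have hm : Measurable fun p : E d × E d => f p.1 p.2 := h.measurable
  have hint : Integrable ψ (push f ν κ) :=
    (h.hasFiniteMoments_push hκ).integrable hψ (c := 1) (by simpa using hle)
  rw [push, integral_map hm.aemeasurable hψ.aestronglyMeasurable, integral_prod]
  exact (integrable_map_measure hψ.aestronglyMeasurable hm.aemeasurable).1 hint

/-- The filter update is Lipschitz for the weighted norm, because it maps a function dominated by
the weight `1 + ‖x‖²` to a function dominated by a multiple of the weight. -/
theorem RegularDynamics.weightedConv_push (h : RegularDynamics f ν) {κ : ℕ → Measure (E d)}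
    {κ' : Measure (E d)} (hc : WeightedConv κ κ') (hκ : ∀ n, HasFiniteMoments (κ n))
    (hκ' : HasFiniteMoments κ') :
    WeightedConv (fun n => push f ν (κ n)) (push f ν κ') := by
  have := h.isProbabilityMeasure
  obtain ⟨ε, hε, H⟩ := hc
  obtain ⟨K, hK, hg⟩ := h.growth
  set s := ∫ w, ‖w‖ ^ 2 ∂ν
  have hs : 0 ≤ s := integral_nonneg fun w => by positivity
  have hint2 : Integrable (fun w : E d => ‖w‖ ^ 2) ν :=
    h.hasFiniteMoments.integrable (by fun_prop) sq_norm_le_weight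
  refine ⟨fun n => (1 + 2 * K ^ 2 * (1 + s)) * ε n, by simpa using hε.const_mul _,
    fun n ψ hψ hle => ?_⟩
  rw [h.integral_push (hκ n) hψ hle, h.integral_push hκ' hψ hle]
  have hm : Measurable fun p : E d × E d => ψ (f p.1 p.2) := hψ.comp h.measurable
  refine abs_integral_sub_le_of_weight (H n)
    (ψ := fun x => ∫ w, ψ (f x w) ∂ν) hm.stronglyMeasurable.integral_prod_right'.measurable
    (by positivity) fun x => ?_
  have hb : ∀ w, |ψ (f x w)| ≤ (1 + 2 * K ^ 2 * ‖x‖ ^ 2) + 2 * K ^ 2 * ‖w‖ ^ 2 := fun w => by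
    have h1 : ‖f x w‖ ^ 2 ≤ (K * (‖x‖ + ‖w‖)) ^ 2 := pow_le_pow_left₀ (norm_nonneg _) (hg _ _) 2
    nlinarith [hle (f x w), mul_nonneg (sq_nonneg K) (sq_nonneg (‖x‖ - ‖w‖))]
  have hbi : Integrable (fun w : E d => (1 + 2 * K ^ 2 * ‖x‖ ^ 2) + 2 * K ^ 2 * ‖w‖ ^ 2) ν :=
    (integrable_const _).add (hint2.const_mul _)
  calc |∫ w, ψ (f x w) ∂ν| ≤ ∫ w, |ψ (f x w)| ∂ν := abs_integral_le_integral_abs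
    _ ≤ ∫ w, ((1 + 2 * K ^ 2 * ‖x‖ ^ 2) + 2 * K ^ 2 * ‖w‖ ^ 2) ∂ν :=
        integral_mono_of_nonneg (Eventually.of_forall fun w => abs_nonneg _) hbi
          (Eventually.of_forall hb)
    _ = (1 + 2 * K ^ 2 * ‖x‖ ^ 2) + 2 * K ^ 2 * s := by
        rw [integral_add (integrable_const _) (hint2.const_mul _), integral_const_mul]
        simp [s]
    _ ≤ (1 + 2 * K ^ 2 * (1 + s)) * (1 + ‖x‖ ^ 2) := by
        have h1 : 0 ≤ 2 * K ^ 2 * s * ‖x‖ ^ 2 := by positivity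
        nlinarith [sq_nonneg K, sq_nonneg ‖x‖]

end Push

/-! ### The value functions -/

section Value

variable {d M : ℕ} {f : E d → E d → E d} {ν : Measure (E d)} {T : ℕ}

theorem measurableSet_cell (Q : Quantizer d M) (i : Fin M) : MeasurableSet (cell Q i) :=
  Q.2 (measurableSet_singleton i)

theorem convexQuantizers_nonempty (hM : 0 < M) : (convexQuantizers d M).Nonempty := by
  refine ⟨⟨fun _ => ⟨0, hM⟩, measurable_const⟩, fun i => ?_⟩
  by_cases h : (⟨0, hM⟩ : Fin M) = i
  · simpa [cell, h] using convex_univ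
  · simpa [cell, h] using convex_empty

/-- The bracket in the dynamic programming recursion, with `k` stages to go after the present
one. -/
noncomputable def stepCost (f : E d → E d → E d) (ν : Measure (E d)) (T k : ℕ)
    (π : Measure (E d)) (Q : Quantizer d M) : ℝ≥0∞ :=
  (T : ℝ≥0∞)⁻¹ * stageCost π Q + expectedNext f ν (valueToGo M f ν T k) π Q

theorem valueToGo_succ (k : ℕ) (π : Measure (E d)) :
    valueToGo M f ν T (k + 1) π = ⨅ Q ∈ convexQuantizers d M, stepCost f ν T k π Q := rfl

theorem stageCost_smul (π : Measure (E d)) (Q : Quantizer d M) {c : ℝ≥0∞} (hc : c ≠ ∞) :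
    stageCost (c • π) Q = c * stageCost π Q := by
  simp only [stageCost_eq_sum_dispersion, Measure.restrict_smul, dispersion_smul _ hc,
    Finset.mul_sum]

theorem cond_smul (π : Measure (E d)) (s : Set (E d)) {c : ℝ≥0∞} (h0 : c ≠ 0) (hc : c ≠ ∞) :
    ProbabilityTheory.cond (c • π) s = ProbabilityTheory.cond π s := by
  rw [ProbabilityTheory.cond, ProbabilityTheory.cond, Measure.smul_apply, smul_eq_mul,
    Measure.restrict_smul, smul_smul, ENNReal.mul_inv (Or.inl h0) (Or.inl hc), mul_right_comm,
    ENNReal.inv_mul_cancel h0 hc, one_mul]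

theorem stepCost_smul (k : ℕ) (π : Measure (E d)) (Q : Quantizer d M) {c : ℝ≥0∞} (hc : c ≠ ∞) :
    stepCost f ν T k (c • π) Q = c * stepCost f ν T k π Q := by
  rcases eq_or_ne c 0 with rfl | h0
  · simp [stepCost, stageCost, expectedNext]
  · simp only [stepCost, expectedNext, stageCost_smul π Q hc, nextBelief, cond_smul π _ h0 hc,
      Measure.smul_apply, smul_eq_mul, mul_add, Finset.mul_sum, mul_left_comm c]

/-- The value functions, extended to all measures by the same recursion, are positively
homogeneous. This makes normalisation unnecessary: see `stepCost_eq`. -/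
theorem valueToGo_smul (hM : 0 < M) (k : ℕ) (π : Measure (E d)) {c : ℝ≥0∞} (hc : c ≠ ∞) :
    valueToGo M f ν T k (c • π) = c * valueToGo M f ν T k π := by
  cases k with
  | zero => simp [valueToGo]
  | succ k =>
    have := (convexQuantizers_nonempty (d := d) hM).to_subtype
    simp only [valueToGo_succ, iInf_subtype', stepCost_smul k π _ hc]
    exact (ENNReal.mul_iInf fun h => absurd h hc).symm

theorem valueToGo_zero_measure (hM : 0 < M) (k : ℕ) :
    valueToGo M f ν T k (0 : Measure (E d)) = 0 := by
  have := valueToGo_smul (f := f) (ν := ν) (T := T) hM k (0 : Measure (E d)) ENNReal.zero_ne_top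
  simpa using this

theorem expectedNext_eq [SFinite ν] (hM : 0 < M) (k : ℕ) (π : Measure (E d)) [IsFiniteMeasure π]
    (Q : Quantizer d M) : expectedNext f ν (valueToGo M f ν T k) π Q =
      ∑ m, valueToGo M f ν T k (push f ν (π.restrict (cell Q m))) := by
  refine Finset.sum_congr rfl fun m _ => ?_
  rcases eq_or_ne (π (cell Q m)) 0 with h0 | h0
  · have : push f ν (0 : Measure (E d)) = 0 := by simp [push]
    rw [h0, mul_zero, Measure.restrict_eq_zero.2 h0, this, valueToGo_zero_measure hM]
  · rw [mul_comm, ← valueToGo_smul hM k _ (measure_ne_top π _), nextBelief_eq_push, ← push_smul,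
      ProbabilityTheory.cond, smul_smul, ENNReal.mul_inv_cancel h0 (measure_ne_top π _), one_smul]

theorem stepCost_eq [SFinite ν] (hM : 0 < M) (k : ℕ) (π : Measure (E d)) [IsFiniteMeasure π]
    (Q : Quantizer d M) : stepCost f ν T k π Q =
      (T : ℝ≥0∞)⁻¹ * ∑ m, dispersion (π.restrict (cell Q m)) +
      ∑ m, valueToGo M f ν T k (push f ν (π.restrict (cell Q m))) := by
  rw [stepCost, expectedNext_eq hM, stageCost_eq_sum_dispersion]

theorem valueToGo_lt_top (hM : 0 < M) (hT : 1 ≤ T) (hd : RegularDynamics f ν) (k : ℕ)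
    {π : Measure (E d)} (hπ : HasFiniteMoments π) : valueToGo M f ν T k π < ∞ := by
  induction k generalizing π with
  | zero => simp [valueToGo]
  | succ k ih =>
    have := hπ.isFiniteMeasure
    have := hd.isProbabilityMeasure
    obtain ⟨Q, hQ⟩ := convexQuantizers_nonempty (d := d) hM
    refine (iInf₂_le Q hQ).trans_lt ?_
    change stepCost f ν T k π Q < ∞
    rw [stepCost_eq hM]
    refine ENNReal.add_lt_top.2 ⟨ENNReal.mul_lt_top ?_ (ENNReal.sum_lt_top.2 fun m _ => ?_),
      ENNReal.sum_lt_top.2 fun m _ => ih (hd.hasFiniteMoments_push (hπ.restrict _))⟩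
    · exact ENNReal.inv_lt_top.2 (by exact_mod_cast hT)
    · exact (dispersion_le _).trans_lt (hπ.restrict _).secondMoment_lt_top

/-- Joint continuity of the bracket in the recursion, in the law and in the quantizer, given the
continuity of the next value function. -/
theorem tendsto_stepCost (hM : 0 < M) (hT : 1 ≤ T) (hd : RegularDynamics f ν) {k : ℕ}
    (hV : ∀ (μ : ℕ → Measure (E d)) (π : Measure (E d)), (∀ n, HasFiniteMoments (μ n)) →
      (∀ n, μ n ≪ volume) → HasFiniteMoments π → π ≪ volume → WeightedConv μ π →
      Tendsto (fun n => valueToGo M f ν T k (μ n)) atTop (𝓝 (valueToGo M f ν T k π)))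
    {μ : ℕ → Measure (E d)} {π : Measure (E d)} (hμ : ∀ n, HasFiniteMoments (μ n))
    (hπ : HasFiniteMoments π) (hc : WeightedConv μ π) {Q : ℕ → Quantizer d M}
    {Q' : Quantizer d M} (hQ : ∀ᵐ x ∂π, ∀ᶠ n in atTop, (Q n).1 x = Q'.1 x) :
    Tendsto (fun n => stepCost f ν T k (μ n) (Q n)) atTop (𝓝 (stepCost f ν T k π Q')) := by
  have := hπ.isFiniteMeasure
  have := fun n => (hμ n).isFiniteMeasure
  have := hd.isProbabilityMeasure
  have hres : ∀ m, WeightedConv (fun n => (μ n).restrict (cell (Q n) m))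
      (π.restrict (cell Q' m)) := fun m =>
    hc.restrict hπ (fun n => measurableSet_cell _ _) (measurableSet_cell _ _) (by
      filter_upwards [hQ] with x hx
      filter_upwards [hx] with n hn
      simp [cell, hn])
  simp only [stepCost_eq hM]
  refine (ENNReal.Tendsto.const_mul (tendsto_finsetSum _ fun m _ => tendsto_dispersion (hres m)
    (fun n => (hμ n).restrict _) (hπ.restrict _)) (Or.inr ?_)).add
    (tendsto_finsetSum _ fun m _ => hV _ _ (fun n => hd.hasFiniteMoments_push ((hμ n).restrict _))
      (fun n => hd.push_absolutelyContinuous _) (hd.hasFiniteMoments_push (hπ.restrict _))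
      (hd.push_absolutelyContinuous _)
      (hd.weightedConv_push (hres m) (fun n => (hμ n).restrict _) (hπ.restrict _)))
  exact ENNReal.inv_ne_top.2 (by exact_mod_cast (by omega : T ≠ 0))

/-- Compactness of the convex-cell quantizers for almost everywhere convergence. -/
theorem exists_subseq_tendsto_quantizer (Q : ℕ → Quantizer d M)
    (hQ : ∀ n, Q n ∈ convexQuantizers d M) : ∃ (φ : ℕ → ℕ) (Q' : Quantizer d M), StrictMono φ ∧
      Q' ∈ convexQuantizers d M ∧ ∀ᵐ x, ∀ᶠ n in atTop, (Q (φ n)).1 x = Q'.1 x := by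
  obtain ⟨φ, Q', hφ, hQ', hlim⟩ :=
    exists_subseq_tendsto_of_convex_fibers volume (fun n => (Q n).1) hQ
  exact ⟨φ, ⟨Q', measurable_of_convex_fibers hQ'⟩, hφ, hQ', hlim⟩

/-- Joint continuity and compactness give an optimal quantizer. -/
theorem exists_stepCost_eq_of_tendsto (hM : 0 < M) (hT : 1 ≤ T) (hd : RegularDynamics f ν) {k : ℕ}
    (hV : ∀ (μ : ℕ → Measure (E d)) (π : Measure (E d)), (∀ n, HasFiniteMoments (μ n)) →
      (∀ n, μ n ≪ volume) → HasFiniteMoments π → π ≪ volume → WeightedConv μ π →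
      Tendsto (fun n => valueToGo M f ν T k (μ n)) atTop (𝓝 (valueToGo M f ν T k π)))
    {π : Measure (E d)} (hπ : HasFiniteMoments π) (hac : π ≪ volume) :
    ∃ Q ∈ convexQuantizers d M, stepCost f ν T k π Q = valueToGo M f ν T (k + 1) π := by
  have hne := (convexQuantizers_nonempty (d := d) hM).image (stepCost f ν T k π)
  obtain ⟨u, -, hu, hmem⟩ := exists_seq_tendsto_sInf hne (OrderBot.bddBelow _)
  choose Q hQ hQu using hmem
  obtain ⟨φ, Q', hφ, hQ', hlim⟩ := exists_subseq_tendsto_quantizer Q hQ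
  refine ⟨Q', hQ', ?_⟩
  have h1 := tendsto_stepCost hM hT hd hV (fun _ => hπ) hπ (WeightedConv.const π)
    (hac.ae_le hlim)
  have h2 := hu.comp hφ.tendsto_atTop
  rw [sInf_image] at h2
  refine tendsto_nhds_unique h1 (h2.congr fun n => ?_)
  exact (hQu (φ n)).symm

/-- The value functions are continuous for weighted convergence of absolutely continuous
measures. -/
theorem tendsto_valueToGo (hM : 0 < M) (hT : 1 ≤ T) (hd : RegularDynamics f ν) (k : ℕ)
    (μ : ℕ → Measure (E d)) (π : Measure (E d)) (hμ : ∀ n, HasFiniteMoments (μ n))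
    (hμac : ∀ n, μ n ≪ volume) (hπ : HasFiniteMoments π) (hac : π ≪ volume)
    (hc : WeightedConv μ π) :
    Tendsto (fun n => valueToGo M f ν T k (μ n)) atTop (𝓝 (valueToGo M f ν T k π)) := by
  induction k generalizing μ π with
  | zero => exact tendsto_const_nhds
  | succ k ih =>
    obtain ⟨Q₀, hQ₀, hopt⟩ := exists_stepCost_eq_of_tendsto hM hT hd ih hπ hac
    refine tendsto_of_subseq_tendsto fun ns hns => ?_
    choose Q hQ hQopt using fun n =>
      exists_stepCost_eq_of_tendsto hM hT hd ih (hμ (ns n)) (hμac (ns n))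
    obtain ⟨φ, Q', hφ, hQ', hlim⟩ := exists_subseq_tendsto_quantizer Q hQ
    have hc' := hc.comp (hns.comp hφ.tendsto_atTop)
    have h1 := tendsto_stepCost hM hT hd ih (fun n => hμ _) hπ hc' (hac.ae_le hlim)
    have h2 := tendsto_stepCost hM hT hd ih (fun n => hμ _) hπ hc' (Q := fun _ => Q₀) (Q' := Q₀)
      (Eventually.of_forall fun x => Eventually.of_forall fun n => rfl)
    simp only [Function.comp_def, hQopt] at h1
    refine ⟨φ, ?_⟩
    have hle : stepCost f ν T k π Q' ≤ stepCost f ν T k π Q₀ :=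
      le_of_tendsto_of_tendsto' h1 h2 fun n => iInf₂_le Q₀ hQ₀
    rw [hopt] at hle
    rwa [le_antisymm hle (iInf₂_le Q' hQ')] at h1

theorem exists_optimal_quantizer (hM : 0 < M) (hT : 1 ≤ T) (hd : RegularDynamics f ν) (k : ℕ)
    {π : Measure (E d)} (hπ : HasFiniteMoments π) (hac : π ≪ volume) :
    ∃ Q ∈ convexQuantizers d M, stepCost f ν T k π Q = valueToGo M f ν T (k + 1) π :=
  exists_stepCost_eq_of_tendsto hM hT hd (tendsto_valueToGo hM hT hd k) hπ hac

/-- For a point mass all quantizers are equally good. -/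
theorem stepCost_dirac [SFinite ν] (hM : 0 < M) (k : ℕ) (x₀ : E d) (Q : Quantizer d M) :
    stepCost f ν T k (Measure.dirac x₀) Q =
      valueToGo M f ν T k (push f ν (Measure.dirac x₀)) := by
  classical
  have h0 : push f ν (0 : Measure (E d)) = 0 := by simp [push]
  have hdisp : ∀ m, dispersion ((Measure.dirac x₀).restrict (cell Q m)) = 0 := fun m => by
    refine le_antisymm ((iInf_le _ x₀).trans ?_) zero_le
    exact (lintegral_mono' Measure.restrict_le_self le_rfl).trans_eq (by simp)
  rw [stepCost_eq hM]
  simp only [hdisp, Finset.sum_const_zero, mul_zero, zero_add]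
  simp only [restrict_dirac]
  rw [Finset.sum_eq_single (Q.1 x₀)]
  · simp [cell]
  · intro m _ hm
    have : x₀ ∉ cell Q m := fun h => hm (Eq.symm h)
    rw [if_neg this, h0, valueToGo_zero_measure hM]
  · simp

theorem exists_optimal_quantizer_dirac [SFinite ν] (hM : 0 < M) (k : ℕ) (x₀ : E d) :
    ∃ Q ∈ convexQuantizers d M,
      stepCost f ν T k (Measure.dirac x₀) Q = valueToGo M f ν T (k + 1) (Measure.dirac x₀) := by
  obtain ⟨Q, hQ⟩ := convexQuantizers_nonempty (d := d) hM
  refine ⟨Q, hQ, le_antisymm (le_iInf₂ fun Q' _ => ?_) (iInf₂_le Q hQ)⟩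
  rw [stepCost_dirac hM]
  exact (stepCost_dirac hM k x₀ Q').ge

/-- For an infinite second moment all quantizers have infinite cost. -/
theorem exists_optimal_quantizer_of_secondMoment_eq_top (hM : 0 < M) (k : ℕ) {π : Measure (E d)}
    [IsFiniteMeasure π] (hπ : secondMoment π = ∞) :
    ∃ Q ∈ convexQuantizers d M, stepCost f ν T k π Q = valueToGo M f ν T (k + 1) π := by
  have htop : ∀ Q : Quantizer d M, stepCost f ν T k π Q = ∞ := by
    intro Q
    have hsum : secondMoment π = ∑ m, secondMoment (π.restrict (cell Q m)) := by
      have hU : (⋃ m, cell Q m) = Set.univ := by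
        ext x; simp [cell]
      rw [secondMoment, ← setLIntegral_univ, ← hU, lintegral_iUnion (measurableSet_cell Q)
        (fun i j hij => (Set.disjoint_singleton.2 hij).preimage Q.1), tsum_fintype]
      rfl
    obtain ⟨m, -, hm⟩ := ENNReal.sum_eq_top.1 (hsum.symm.trans hπ)
    have hs : stageCost π Q = ∞ := by
      rw [stageCost_eq_sum_dispersion]
      exact ENNReal.sum_eq_top.2 ⟨m, Finset.mem_univ m, dispersion_eq_top hm⟩
    rw [stepCost, hs, ENNReal.mul_top (ENNReal.inv_ne_zero.2 (ENNReal.natCast_ne_top T)), top_add]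
  obtain ⟨Q, hQ⟩ := convexQuantizers_nonempty (d := d) hM
  refine ⟨Q, hQ, le_antisymm (le_iInf₂ fun Q' _ => ?_) (iInf₂_le Q hQ)⟩
  exact (htop Q).le.trans (htop Q').ge

end Value

/-! ### Weak convergence of laws with Lipschitz densities -/

section SmoothLaws

variable {d : ℕ}

/-- A Lipschitz density is recovered, with a uniform error, from the masses of small balls. -/
theorem abs_setAverage_sub_le_of_lipschitz {g : E d → ℝ} {C₁ : ℝ≥0} (hg0 : ∀ z, 0 ≤ g z)
    (hg : LipschitzWith C₁ g) (z : E d) {r : ℝ} (hr : 0 < r) :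
    |(volume.withDensity fun y => ENNReal.ofReal (g y)).real (Metric.ball z r) /
      volume.real (Metric.ball z r) - g z| ≤ C₁ * r := by
  have hv : 0 < volume.real (Metric.ball z r) := ENNReal.toReal_pos
    (Metric.measure_ball_pos _ _ hr).ne' measure_ball_lt_top.ne
  have hb : ∀ y ∈ Metric.ball z r, ‖g y - g z‖ ≤ C₁ * r := fun y hy =>
    (hg.norm_sub_le y z).trans (mul_le_mul_of_nonneg_left
      (by simpa [dist_eq_norm] using (Metric.mem_ball.1 hy).le) C₁.2)
  have hint : IntegrableOn g (Metric.ball z r) :=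
    (hg.continuous.continuousOn.integrableOn_compact (isCompact_closedBall z r)).mono_set
      Metric.ball_subset_closedBall
  have h1 : (volume.withDensity fun y => ENNReal.ofReal (g y)).real (Metric.ball z r)
      = ∫ y in Metric.ball z r, g y := by
    rw [integral_eq_lintegral_of_nonneg_ae (Eventually.of_forall hg0) hint.1, measureReal_def,
      withDensity_apply _ measurableSet_ball]
  have hconst : IntegrableOn (fun _ => g z) (Metric.ball z r) volume :=
    integrableOn_const (measure_ball_lt_top (μ := (volume : Measure (E d)))).ne
  have h2 := norm_setIntegral_le_of_norm_le_const
    (measure_ball_lt_top (μ := (volume : Measure (E d)))) hb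
  rw [integral_sub hint hconst, setIntegral_const, Real.norm_eq_abs, smul_eq_mul] at h2
  rw [h1, div_sub' hv.ne', abs_div, abs_of_pos hv, div_le_iff₀ hv]
  exact h2

/-- Weak convergence of laws with uniformly Lipschitz densities implies pointwise convergence of
the densities. -/
theorem tendsto_density_of_tendsto {C₁ : ℝ≥0} {μ : ℕ → ProbabilityMeasure (E d)}
    {π : ProbabilityMeasure (E d)} {g : ℕ → E d → ℝ} {g' : E d → ℝ}
    (hg0 : ∀ n z, 0 ≤ g n z) (hg : ∀ n, LipschitzWith C₁ (g n))
    (hμ : ∀ n, (μ n : Measure (E d)) = volume.withDensity fun z => ENNReal.ofReal (g n z))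
    (hg0' : ∀ z, 0 ≤ g' z) (hg' : LipschitzWith C₁ g')
    (hπ : (π : Measure (E d)) = volume.withDensity fun z => ENNReal.ofReal (g' z))
    (h : Tendsto μ atTop (𝓝 π)) (z : E d) :
    Tendsto (fun n => g n z) atTop (𝓝 (g' z)) := by
  rw [Metric.tendsto_atTop]
  intro ε hε
  obtain ⟨r, hr, hrε⟩ : ∃ r : ℝ, 0 < r ∧ C₁ * r < ε / 3 := by
    refine ⟨ε / 3 / (C₁ + 1), by positivity, ?_⟩
    rw [mul_div_assoc', div_lt_iff₀ (by positivity)]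
    nlinarith [C₁.2]
  have hfr : (π : Measure (E d)) (frontier (Metric.ball z r)) = 0 := by
    rw [hπ]
    exact withDensity_absolutelyContinuous _ _ ((convex_ball z r).addHaar_frontier volume)
  have h1 := ProbabilityMeasure.tendsto_measure_of_null_frontier_of_tendsto' h hfr
  have h2 : Tendsto (fun n => (μ n : Measure (E d)).real (Metric.ball z r) /
      volume.real (Metric.ball z r)) atTop
      (𝓝 ((π : Measure (E d)).real (Metric.ball z r) / volume.real (Metric.ball z r))) :=
    ((ENNReal.tendsto_toReal (measure_ne_top _ _)).comp h1).div_const _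
  obtain ⟨N, hN⟩ := Metric.tendsto_atTop.1 h2 (ε / 3) (by positivity)
  refine ⟨N, fun n hn => ?_⟩
  have h3 := hN n hn
  have h4 := abs_setAverage_sub_le_of_lipschitz (hg0 n) (hg n) z hr
  have h5 := abs_setAverage_sub_le_of_lipschitz hg0' hg' z hr
  rw [← hμ] at h4
  rw [← hπ] at h5
  rw [Real.dist_eq, abs_lt] at h3 ⊢
  rw [abs_le] at h4 h5
  constructor <;> linarith [h3.1, h3.2, h4.1, h4.2, h5.1, h5.2]

theorem lintegral_smoothLaw {g : E d → ℝ} (hg : Measurable g) {μ : Measure (E d)}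
    (hμ : μ = volume.withDensity fun z => ENNReal.ofReal (g z)) {F : E d → ℝ≥0∞}
    (hF : Measurable F) {s : Set (E d)} (hs : MeasurableSet s) :
    ∫⁻ x in s, F x ∂μ = ∫⁻ x in s, ENNReal.ofReal (g x) * F x := by
  rw [hμ, restrict_withDensity hs,
    lintegral_withDensity_eq_lintegral_mul _ (by fun_prop) hF]
  rfl

theorem integral_smoothLaw {g : E d → ℝ} (hg : Measurable g) (hg0 : ∀ z, 0 ≤ g z)
    {μ : Measure (E d)} (hμ : μ = volume.withDensity fun z => ENNReal.ofReal (g z))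
    (ψ : E d → ℝ) : ∫ x, ψ x ∂μ = ∫ x, g x * ψ x := by
  rw [hμ]
  refine (integral_withDensity_eq_integral_smul hg.real_toNNReal ψ).trans ?_
  refine integral_congr_ae (Eventually.of_forall fun x => ?_)
  simp [NNReal.smul_def, hg0 x]

theorem integrable_smoothLaw {g : E d → ℝ} (hg : Measurable g) (hg0 : ∀ z, 0 ≤ g z)
    {μ : Measure (E d)} (hμ : μ = volume.withDensity fun z => ENNReal.ofReal (g z))
    {ψ : E d → ℝ} (hψ : Integrable ψ μ) : Integrable fun x => g x * ψ x := by
  rw [hμ] at hψ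
  refine ((integrable_withDensity_iff_integrable_smul hg.real_toNNReal).1 hψ).congr
    (Eventually.of_forall fun x => ?_)
  simp [NNReal.smul_def, hg0 x]

theorem absolutelyContinuous_of_mem_smoothLaws {C : ℝ} {C₁ : ℝ≥0} {μ : ProbabilityMeasure (E d)}
    (h : μ ∈ smoothLaws d C C₁) : (μ : Measure (E d)) ≪ volume := by
  obtain ⟨g, -, -, hμ⟩ := h
  rw [hμ]
  exact withDensity_absolutelyContinuous _ _

/-- On the laws with bounded, uniformly Lipschitz densities, weak convergence together with uniform
integrability of `‖x‖²` implies weighted convergence: the densities converge pointwise, hence in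
`L¹` on balls, and uniform integrability controls the tails. -/
theorem weightedConv_of_mem_smoothLaws {C : ℝ} {C₁ : ℝ≥0} {μ : ℕ → ProbabilityMeasure (E d)}
    {π : ProbabilityMeasure (E d)} (hμ : ∀ n, μ n ∈ smoothLaws d C C₁)
    (hπ : π ∈ smoothLaws d C C₁) (h : Tendsto μ atTop (𝓝 π)) (hUI : UnifIntegrableSq μ) :
    (∀ n, HasFiniteMoments (μ n : Measure (E d))) ∧ HasFiniteMoments (π : Measure (E d)) ∧
      WeightedConv (fun n => (μ n : Measure (E d))) π := by
  choose g hgb hgl hgμ using hμ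
  obtain ⟨g', hgb', hgl', hgπ⟩ := hπ
  have hgm : ∀ n, Measurable (g n) := fun n => (hgl n).continuous.measurable
  have hgm' : Measurable g' := hgl'.continuous.measurable
  have hpt : ∀ z, Tendsto (fun n => g n z) atTop (𝓝 (g' z)) :=
    tendsto_density_of_tendsto (fun n z => (hgb n z).1) hgl hgμ (fun z => (hgb' z).1) hgl' hgπ h
  have hsq : Measurable fun x : E d => ENNReal.ofReal (‖x‖ ^ 2) := by fun_prop
  -- Fatou's lemma passes bounds on second moments over a set to the limit
  have hfatou : ∀ (s : Set (E d)), MeasurableSet s → ∀ c : ℝ≥0∞,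
      (∀ n, ∫⁻ x in s, ENNReal.ofReal (‖x‖ ^ 2) ∂(μ n : Measure (E d)) ≤ c) →
      ∫⁻ x in s, ENNReal.ofReal (‖x‖ ^ 2) ∂(π : Measure (E d)) ≤ c := by
    intro s hs c hc
    rw [lintegral_smoothLaw hgm' hgπ hsq hs]
    have hlim : ∀ x, liminf (fun n => ENNReal.ofReal (g n x) * ENNReal.ofReal (‖x‖ ^ 2)) atTop
        = ENNReal.ofReal (g' x) * ENNReal.ofReal (‖x‖ ^ 2) := fun x =>
      (ENNReal.Tendsto.mul_const (ENNReal.tendsto_ofReal (hpt x))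
        (Or.inr ENNReal.ofReal_ne_top)).liminf_eq
    calc _ = ∫⁻ x in s, liminf (fun n => ENNReal.ofReal (g n x) * ENNReal.ofReal (‖x‖ ^ 2)) atTop :=
          lintegral_congr fun x => (hlim x).symm
      _ ≤ liminf (fun n => ∫⁻ x in s, ENNReal.ofReal (g n x) * ENNReal.ofReal (‖x‖ ^ 2)) atTop :=
          lintegral_liminf_le fun n => by have := hgm n; fun_prop
      _ ≤ c := by
          refine liminf_le_of_le (by isBoundedDefault) fun b hb => ?_
          obtain ⟨n, hn⟩ := hb.exists
          rw [← lintegral_smoothLaw (hgm n) (hgμ n) hsq hs] at hn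
          exact hn.trans (hc n)
  have htail : ∀ δ : ℝ≥0∞, 0 < δ → ∃ L : ℝ, 1 ≤ L ∧ ∀ n,
      ∫⁻ x in {x : E d | L ≤ ‖x‖ ^ 2}, ENNReal.ofReal (‖x‖ ^ 2) ∂(μ n : Measure (E d)) ≤ δ := by
    intro δ hδ
    obtain ⟨L, hL, hL1⟩ :=
      ((ENNReal.tendsto_nhds_zero.1 hUI δ hδ).and (eventually_ge_atTop (1 : ℝ))).exists
    exact ⟨L, hL1, fun n => (le_iSup (f := fun n => ∫⁻ x in {x : E d | L ≤ ‖x‖ ^ 2},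
      ENNReal.ofReal (‖x‖ ^ 2) ∂(μ n : Measure (E d))) n).trans hL⟩
  have hmeas : ∀ L : ℝ, MeasurableSet {x : E d | L ≤ ‖x‖ ^ 2} := fun L =>
    measurableSet_le measurable_const (by fun_prop)
  obtain ⟨L₀, -, hL₀⟩ := htail 1 one_pos
  have hbound : ∀ n, ∫⁻ x, ENNReal.ofReal (‖x‖ ^ 2) ∂(μ n : Measure (E d)) ≤
      1 + ENNReal.ofReal L₀ := by
    intro n
    rw [← lintegral_add_compl _ (hmeas L₀)]
    refine add_le_add (hL₀ n) ?_
    calc ∫⁻ x in {x : E d | L₀ ≤ ‖x‖ ^ 2}ᶜ, ENNReal.ofReal (‖x‖ ^ 2) ∂(μ n : Measure (E d))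
        ≤ ∫⁻ x in {x : E d | L₀ ≤ ‖x‖ ^ 2}ᶜ, ENNReal.ofReal L₀ ∂(μ n : Measure (E d)) :=
          setLIntegral_mono measurable_const fun x hx =>
            ENNReal.ofReal_le_ofReal (not_le.1 (show ¬L₀ ≤ ‖x‖ ^ 2 from hx)).le
      _ ≤ ENNReal.ofReal L₀ := by
          rw [setLIntegral_const]
          exact mul_le_of_le_one_right zero_le prob_le_one
  have hFμ : ∀ n, HasFiniteMoments (μ n : Measure (E d)) := fun n =>
    ⟨inferInstance, (hbound n).trans_lt (by simp)⟩
  have hFπ : HasFiniteMoments (π : Measure (E d)) := by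
    refine ⟨inferInstance, lt_of_le_of_lt ?_ (by simp : 1 + ENNReal.ofReal L₀ < ∞)⟩
    have := hfatou Set.univ MeasurableSet.univ _ (fun n => by
      rw [setLIntegral_univ]; exact hbound n)
    rwa [setLIntegral_univ] at this
  refine ⟨hFμ, hFπ, ?_⟩
  have hw : Measurable fun x : E d => 1 + ‖x‖ ^ 2 := by fun_prop
  let e : ℕ → E d → ℝ := fun n x => |g n x - g' x| * (1 + ‖x‖ ^ 2)
  have hem : ∀ n, Measurable (e n) := fun n => ((hgm n).sub hgm').abs.mul hw
  have he0 : ∀ n x, 0 ≤ e n x := fun n x => by positivity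
  have hei : ∀ n, Integrable (e n) := fun n => by
    have h1 := integrable_smoothLaw (hgm n) (fun z => (hgb n z).1) (hgμ n)
      (hFμ n).integrable_weight
    have h2 := integrable_smoothLaw hgm' (fun z => (hgb' z).1) hgπ hFπ.integrable_weight
    refine (h1.sub h2).abs.congr (Eventually.of_forall fun x => ?_)
    have h3 : (0 : ℝ) ≤ 1 + ‖x‖ ^ 2 := by positivity
    simp only [Pi.sub_apply, ← sub_mul, abs_mul, abs_of_nonneg h3, e]
  have hlim : Tendsto (fun n => ∫⁻ x, ENNReal.ofReal (e n x)) atTop (𝓝 0) := by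
    rw [ENNReal.tendsto_nhds_zero]
    intro δ hδ
    obtain ⟨η, hη, hηδ⟩ : ∃ η : ℝ≥0∞, 0 < η ∧ η + ENNReal.ofReal 2 * (η + η) ≤ δ := by
      rcases eq_or_ne δ ∞ with rfl | hδt
      · exact ⟨1, one_pos, le_top⟩
      · refine ⟨δ / 5, ENNReal.div_pos hδ.ne' (by simp), le_of_eq ?_⟩
        rw [ENNReal.ofReal_ofNat, ← two_mul, ← mul_assoc]
        calc δ / 5 + 2 * 2 * (δ / 5) = 5 * (δ / 5) := by ring
          _ = δ := ENNReal.mul_div_cancel (by simp) (by simp)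
    obtain ⟨L, hL1, hL⟩ := htail η hη
    set S := {x : E d | L ≤ ‖x‖ ^ 2} with hS
    have hSc : volume Sᶜ < ∞ := by
      refine (measure_mono (fun x hx => ?_ : Sᶜ ⊆ Metric.closedBall 0 L)).trans_lt
        measure_closedBall_lt_top
      have hx' : ‖x‖ ^ 2 < L := not_le.1 hx
      rw [mem_closedBall_zero_iff]
      nlinarith [norm_nonneg x]
    have hin : Tendsto (fun n => ∫⁻ x in Sᶜ, ENNReal.ofReal (e n x)) atTop (𝓝 0) := by
      have := tendsto_lintegral_of_dominated_convergence (μ := volume.restrict Sᶜ)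
        (F := fun n x => ENNReal.ofReal (e n x)) (f := fun _ => 0)
        (fun _ => ENNReal.ofReal (C * (1 + L))) (fun n => (hem n).ennreal_ofReal) (fun n => by
          refine (ae_restrict_iff' (hmeas L).compl).2 (Eventually.of_forall fun x hx => ?_)
          refine ENNReal.ofReal_le_ofReal ?_
          have hx' : ‖x‖ ^ 2 < L := not_le.1 hx
          have h1 : |g n x - g' x| ≤ C := by
            rw [abs_le]
            constructor <;> linarith [(hgb n x).1, (hgb n x).2, (hgb' x).1, (hgb' x).2]
          exact mul_le_mul h1 (by linarith) (by positivity) ((abs_nonneg _).trans h1))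
        (by
          rw [lintegral_const, Measure.restrict_apply_univ]
          exact ENNReal.mul_ne_top ENNReal.ofReal_ne_top hSc.ne)
        (Eventually.of_forall fun x => by
          have h1 : Tendsto (fun n => e n x) atTop (𝓝 (|g' x - g' x| * (1 + ‖x‖ ^ 2))) :=
            (((hpt x).sub_const _).abs).mul_const _
          simpa using ENNReal.tendsto_ofReal h1)
      simpa using this
    filter_upwards [ENNReal.tendsto_nhds_zero.1 hin η hη] with n hn
    rw [← lintegral_add_compl _ (hmeas L), add_comm]
    refine (add_le_add hn ?_).trans hηδ
    calc ∫⁻ x in S, ENNReal.ofReal (e n x)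
        ≤ ∫⁻ x in S, ENNReal.ofReal 2 * (ENNReal.ofReal (g n x) * ENNReal.ofReal (‖x‖ ^ 2)
            + ENNReal.ofReal (g' x) * ENNReal.ofReal (‖x‖ ^ 2)) := by
          have := hgm n
          refine setLIntegral_mono (by fun_prop) fun x hx => ?_
          rw [← ENNReal.ofReal_mul (hgb n x).1, ← ENNReal.ofReal_mul (hgb' x).1,
            ← ENNReal.ofReal_add (mul_nonneg (hgb n x).1 (by positivity))
              (mul_nonneg (hgb' x).1 (by positivity)), ← ENNReal.ofReal_mul (by norm_num)]
          refine ENNReal.ofReal_le_ofReal ?_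
          have hx' : L ≤ ‖x‖ ^ 2 := hx
          have h1 : |g n x - g' x| ≤ g n x + g' x := by
            rw [abs_le]
            constructor <;> linarith [(hgb n x).1, (hgb' x).1]
          calc |g n x - g' x| * (1 + ‖x‖ ^ 2) ≤ (g n x + g' x) * (2 * ‖x‖ ^ 2) :=
                mul_le_mul h1 (by linarith) (by positivity) ((abs_nonneg _).trans h1)
            _ = 2 * (g n x * ‖x‖ ^ 2 + g' x * ‖x‖ ^ 2) := by ring
      _ = ENNReal.ofReal 2 * (∫⁻ x in S, ENNReal.ofReal (‖x‖ ^ 2) ∂(μ n : Measure (E d))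
            + ∫⁻ x in S, ENNReal.ofReal (‖x‖ ^ 2) ∂(π : Measure (E d))) := by
          have := hgm n
          rw [lintegral_const_mul _ (by fun_prop), lintegral_add_left (by fun_prop),
            lintegral_smoothLaw (hgm n) (hgμ n) hsq (hmeas L),
            lintegral_smoothLaw hgm' hgπ hsq (hmeas L)]
      _ ≤ ENNReal.ofReal 2 * (η + η) := by
          gcongr
          · exact hL n
          · exact hfatou S (hmeas L) η hL
  refine ⟨fun n => ∫ x, e n x, ?_, fun n ψ hψ hle => ?_⟩
  · have h1 : ∀ n, ∫ x, e n x = (∫⁻ x, ENNReal.ofReal (e n x)).toReal := fun n =>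
      integral_eq_lintegral_of_nonneg_ae (Eventually.of_forall (he0 n)) (hem n).aestronglyMeasurable
    simp only [h1]
    exact (ENNReal.tendsto_toReal ENNReal.zero_ne_top).comp hlim
  · have hψ1 : ∀ x, |ψ x| ≤ 1 * (1 + ‖x‖ ^ 2) := fun x => by simpa using hle x
    rw [integral_smoothLaw (hgm n) (fun z => (hgb n z).1) (hgμ n),
      integral_smoothLaw hgm' (fun z => (hgb' z).1) hgπ, ← integral_sub
        (integrable_smoothLaw (hgm n) (fun z => (hgb n z).1) (hgμ n) ((hFμ n).integrable hψ hψ1))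
        (integrable_smoothLaw hgm' (fun z => (hgb' z).1) hgπ (hFπ.integrable hψ hψ1))]
    refine abs_integral_le_integral_abs.trans (integral_mono_of_nonneg
      (Eventually.of_forall fun x => abs_nonneg _) (hei n) (Eventually.of_forall fun x => ?_))
    simp only [← sub_mul, abs_mul, e]
    exact mul_le_mul_of_nonneg_left (hle x) (abs_nonneg _)

end SmoothLaws

/-! ### Independence of the noise from the past -/

section Source

variable {d M : ℕ} {Ω : Type*} [mΩ : MeasurableSpace Ω] {P : Measure Ω}
  {f : E d → E d → E d} {X₀ : Ω → E d} {W : ℕ → Ω → E d} {π₀ ν : Measure (E d)}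

/-- If `X` is independent of the pair `(A, B)`, and `A` is independent of `B`, then the pair
`(X, A)` is independent of `B`. -/
theorem indepFun_prodMk_of_indepFun [IsProbabilityMeasure P] {α β γ : Type*} [MeasurableSpace α] [MeasurableSpace β]
    [MeasurableSpace γ] {X : Ω → α} {A : Ω → β} {B : Ω → γ} (hX : Measurable X)
    (hA : Measurable A) (hB : Measurable B) (h : IndepFun X (fun ω => (A ω, B ω)) P)
    (hAB : IndepFun A B P) : IndepFun (fun ω => (X ω, A ω)) B P := by
  have h1 := (indepFun_iff_map_prod_eq_prod_map_map hX.aemeasurable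
    (hA.prodMk hB).aemeasurable).1 h
  have h2 := (indepFun_iff_map_prod_eq_prod_map_map hA.aemeasurable hB.aemeasurable).1 hAB
  have h3 : P.map (fun ω => (X ω, A ω)) = (P.map X).prod (P.map A) :=
    (indepFun_iff_map_prod_eq_prod_map_map hX.aemeasurable hA.aemeasurable).1
      (h.comp measurable_id measurable_fst)
  have := Measure.isProbabilityMeasure_map (μ := P) hX.aemeasurable
  have := Measure.isProbabilityMeasure_map (μ := P) hA.aemeasurable
  have := Measure.isProbabilityMeasure_map (μ := P) hB.aemeasurable
  rw [indepFun_iff_map_prod_eq_prod_map_map (hX.prodMk hA).aemeasurable hB.aemeasurable, h3]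
  rw [h2, ← Measure.prodAssoc_prod] at h1
  have h4 := congrArg (Measure.map MeasurableEquiv.prodAssoc.symm) h1
  rw [Measure.map_map MeasurableEquiv.prodAssoc.symm.measurable (by fun_prop),
    Measure.map_map MeasurableEquiv.prodAssoc.symm.measurable (by fun_prop),
    MeasurableEquiv.symm_comp_self, Measure.map_id] at h4
  exact h4

/-- The standing hypotheses on the source: measurability, the law of the initial state, and
i.i.d. noise that is independent of the initial state. -/
structure IsSource (P : Measure Ω) (f : E d → E d → E d) (X₀ : Ω → E d) (W : ℕ → Ω → E d)
    (π₀ ν : Measure (E d)) : Prop where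
  measurable_dynamics : Measurable (Function.uncurry f)
  measurable_init : Measurable X₀
  measurable_noise : ∀ t, Measurable (W t)
  law_init : P.map X₀ = π₀
  law_noise : ∀ t, P.map (W t) = ν
  iIndepFun_noise : iIndepFun W P
  indepFun_init : IndepFun X₀ (fun ω t => W t ω) P

/-- The σ-algebra generated by the initial state and the noise before time `t`. -/
abbrev pastAlgebra (X₀ : Ω → E d) (W : ℕ → Ω → E d) (t : ℕ) : MeasurableSpace Ω :=
  MeasurableSpace.comap (fun ω => (X₀ ω, fun i : Finset.range t => W i ω)) inferInstance

theorem IsSource.pastAlgebra_le (hs : IsSource P f X₀ W π₀ ν) (t : ℕ) :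
    pastAlgebra X₀ W t ≤ mΩ :=
  Measurable.comap_le (hs.measurable_init.prodMk
    (measurable_pi_lambda _ fun i => hs.measurable_noise i))

theorem IsSource.indep_pastAlgebra [IsProbabilityMeasure P] (hs : IsSource P f X₀ W π₀ ν) (t : ℕ) :
    Indep (pastAlgebra X₀ W t) (MeasurableSpace.comap (W t) inferInstance) P := by
  have hA : Measurable fun ω (i : Finset.range t) => W i ω :=
    measurable_pi_lambda _ fun i => hs.measurable_noise i
  have h1 : IndepFun (fun ω (i : Finset.range t) => W i ω) (W t) P :=
    (hs.iIndepFun_noise.indepFun_finset (Finset.range t) {t} (by simp)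
      hs.measurable_noise).comp measurable_id
      (measurable_pi_apply (⟨t, Finset.mem_singleton_self t⟩ : ({t} : Finset ℕ)))
  have h2 : IndepFun X₀ (fun ω => ((fun i : Finset.range t => W i ω), W t ω)) P :=
    hs.indepFun_init.comp measurable_id
      (ψ := fun w : ℕ → E d => ((fun i : Finset.range t => w i), w t)) (by fun_prop)
  exact (IndepFun_iff_Indep _ _ _).1
    (indepFun_prodMk_of_indepFun hs.measurable_init hA (hs.measurable_noise t) h2 h1)

theorem IsSource.measurable_source_pastAlgebra (hs : IsSource P f X₀ W π₀ ν) {t s : ℕ}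
    (hst : s ≤ t) : Measurable[pastAlgebra X₀ W t] (source f X₀ W s) := by
  have hZ : Measurable[pastAlgebra X₀ W t]
      (fun ω => (X₀ ω, fun i : Finset.range t => W i ω)) := comap_measurable _
  induction s with
  | zero => exact measurable_fst.comp hZ
  | succ s ih =>
    have h1 := ih (by omega)
    have h2 : Measurable[pastAlgebra X₀ W t] (W s) :=
      (measurable_pi_apply (⟨s, Finset.mem_range.2 (by omega)⟩ : Finset.range t)).comp
        (measurable_snd.comp hZ)
    have h3 : Measurable[pastAlgebra X₀ W t] fun ω => (source f X₀ W s ω, W s ω) := h1.prodMk h2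
    exact hs.measurable_dynamics.comp h3

theorem IsSource.measurable_source (hs : IsSource P f X₀ W π₀ ν) (t : ℕ) :
    Measurable (source f X₀ W t) :=
  (hs.measurable_source_pastAlgebra le_rfl).mono (hs.pastAlgebra_le t) le_rfl

/-- The message at time `t` is a measurable function of the source up to time `t`. -/
theorem Policy.measurable_message (η : Policy d M) {Ω : Type*} {m : MeasurableSpace Ω} {X : ℕ → Ω → E d}
    (t : ℕ) (hX : ∀ s ≤ t, Measurable[m] (X s)) :
    Measurable[m] fun ω => η.message (fun s => X s ω) t := by
  induction t using Nat.strong_induction_on with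
  | _ t ih =>
    have h1 : (fun ω => η.message (fun s => X s ω) t) = fun ω =>
        η.enc t (fun i : Fin t => η.message (fun s => X s ω) i,
          fun i : Fin (t + 1) => X i ω) := by
      funext ω; rw [Policy.message]
    rw [h1]
    refine (η.measurable_enc t).comp (Measurable.prodMk ?_ ?_)
    · exact measurable_pi_lambda _ fun i => ih i i.2 fun s hs => hX s (by omega)
    · exact measurable_pi_lambda _ fun i => hX i (by omega)

theorem Policy.measurable_history (η : Policy d M) {Ω : Type*} {m : MeasurableSpace Ω} {X : ℕ → Ω → E d}
    (t : ℕ) (hX : ∀ s, s < t → Measurable[m] (X s)) : Measurable[m] (η.history X t) :=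
  measurable_pi_lambda _ fun i => η.measurable_message _ fun s hs => hX s (by omega)

/-- Restricting to an event of the past keeps the noise independent of the past. -/
theorem map_restrict_prodMk_of_indep {Ω : Type*} {m mΩ : MeasurableSpace Ω} {P : Measure Ω}
    [IsProbabilityMeasure P] (hm : m ≤ mΩ) {X V : Ω → E d}
    {A : Set Ω} (hX : Measurable[m] X) (hV : Measurable V) (hA : MeasurableSet[m] A)
    (h : Indep m (MeasurableSpace.comap V inferInstance) P) :
    (P.restrict A).map (fun ω => (X ω, V ω)) = ((P.restrict A).map X).prod (P.map V) := by
  have hX' : Measurable X := hX.mono hm le_rfl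
  have := Measure.isProbabilityMeasure_map (μ := P) hV.aemeasurable
  refine (Measure.prod_eq fun s t hs ht => ?_).symm
  rw [Measure.map_apply (hX'.prodMk hV) (hs.prod ht), Measure.map_apply hX' hs,
    Measure.map_apply hV ht, Measure.restrict_apply ((hX'.prodMk hV) (hs.prod ht)),
    Measure.restrict_apply (hX' hs)]
  have h1 := (Indep_iff _ _ _).1 h (X ⁻¹' s ∩ A) (V ⁻¹' t) ((hX hs).inter hA) ⟨t, ht, rfl⟩
  rw [← h1]
  congr 1
  ext ω
  simp only [Set.mem_inter_iff, Set.mem_preimage, Set.mem_prod]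
  tauto

end Source

/-! ### Laws along the branches of the message tree -/

section Branches

variable {d M : ℕ} {Ω : Type*} [mΩ : MeasurableSpace Ω] {P : Measure Ω}
  {f : E d → E d → E d} {X₀ : Ω → E d} {W : ℕ → Ω → E d} {π₀ ν : Measure (E d)} {T : ℕ}

/-- The law of `x_t` on the event that the message history is `h`, not normalised. -/
noncomputable def Policy.branchLaw (η : Policy d M) (P : Measure Ω) (X : ℕ → Ω → E d) (t : ℕ)
    (h : Fin t → Fin M) : Measure (E d) :=
  (P.restrict (η.history X t ⁻¹' {h})).map (X t)

/-- Almost surely, the message at time `t` is produced by a quantizer that depends only on the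
message history. -/
def Policy.Follows (η : Policy d M) (P : Measure Ω) (X : ℕ → Ω → E d)
    (q : (t : ℕ) → (Fin t → Fin M) → Quantizer d M) : Prop :=
  ∀ t, ∀ᵐ ω ∂P, η.message (fun s => X s ω) t = (q t (η.history X t ω)).1 (X t ω)

theorem Policy.history_succ_eq_iff (η : Policy d M) {Ω : Type*} (X : ℕ → Ω → E d) (t : ℕ) (ω : Ω)
    (h : Fin (t + 1) → Fin M) : η.history X (t + 1) ω = h ↔
      η.history X t ω = Fin.init h ∧ η.message (fun s => X s ω) t = h (Fin.last t) := by
  constructor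
  · rintro rfl
    exact ⟨rfl, rfl⟩
  · rintro ⟨h1, h2⟩
    rw [← Fin.snoc_init_self h, ← h1, ← h2]
    exact (Fin.snoc_init_self (η.history X (t + 1) ω)).symm

theorem Policy.branchLaw_zero (η : Policy d M) (hs : IsSource P f X₀ W π₀ ν)
    (h : Fin 0 → Fin M) : η.branchLaw P (source f X₀ W) 0 h = π₀ := by
  have : η.history (source f X₀ W) 0 ⁻¹' {h} = Set.univ := by
    ext ω; simp [Subsingleton.elim (η.history (source f X₀ W) 0 ω) h]
  rw [Policy.branchLaw, this, Measure.restrict_univ]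
  exact hs.law_init

/-- Receiving one more message restricts the law of `x_t` to the corresponding cell. -/
theorem Policy.Follows.map_restrict {η : Policy d M} {X : ℕ → Ω → E d}
    {q : (t : ℕ) → (Fin t → Fin M) → Quantizer d M} (hq : η.Follows P X q)
    (hX : ∀ t, Measurable (X t)) (t : ℕ) (h : Fin (t + 1) → Fin M) :
    (P.restrict (η.history X (t + 1) ⁻¹' {h})).map (X t) =
      (η.branchLaw P X t (Fin.init h)).restrict (cell (q t (Fin.init h)) (h (Fin.last t))) := by
  rw [Policy.branchLaw, Measure.restrict_map (hX t) (measurableSet_cell _ _),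
    Measure.restrict_restrict (hX t (measurableSet_cell _ _))]
  congr 1
  refine Measure.restrict_congr_set ?_
  filter_upwards [hq t] with ω hω
  refine propext ?_
  change η.history X (t + 1) ω = h ↔ (q t (Fin.init h)).1 (X t ω) = h (Fin.last t) ∧
    η.history X t ω = Fin.init h
  rw [η.history_succ_eq_iff, hω]
  constructor
  · rintro ⟨h1, h2⟩
    exact ⟨h1 ▸ h2, h1⟩
  · rintro ⟨h1, h2⟩
    exact ⟨h2, h2 ▸ h1⟩

/-- The filter recursion, for the unnormalised laws. -/
theorem Policy.Follows.branchLaw_succ [IsProbabilityMeasure P] {η : Policy d M} (hs : IsSource P f X₀ W π₀ ν)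
    {q : (t : ℕ) → (Fin t → Fin M) → Quantizer d M} (hq : η.Follows P (source f X₀ W) q) (t : ℕ)
    (h : Fin (t + 1) → Fin M) : η.branchLaw P (source f X₀ W) (t + 1) h =
      push f ν ((η.branchLaw P (source f X₀ W) t (Fin.init h)).restrict
        (cell (q t (Fin.init h)) (h (Fin.last t)))) := by
  have hX := hs.measurable_source
  rw [← hq.map_restrict hX, push, ← hs.law_noise t,
    ← map_restrict_prodMk_of_indep (hs.pastAlgebra_le t) (hs.measurable_source_pastAlgebra le_rfl)
      (hs.measurable_noise t) ?_ (hs.indep_pastAlgebra t), Measure.map_map ?_ ?_]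
  · rfl
  · exact hs.measurable_dynamics
  · exact (hX t).prodMk (hs.measurable_noise t)
  · exact η.measurable_history (t + 1)
      (fun s hst => hs.measurable_source_pastAlgebra (Nat.lt_succ_iff.1 hst))
      (measurableSet_singleton h)

theorem sum_histories_succ {t : ℕ} (F : (Fin t → Fin M) → Fin M → ℝ≥0∞) :
    ∑ h : Fin (t + 1) → Fin M, F (Fin.init h) (h (Fin.last t)) = ∑ h, ∑ m, F h m := by
  rw [← Equiv.sum_comp (Fin.snocEquiv fun _ => Fin M), Fintype.sum_prod_type_right]
  simp [Fin.snocEquiv]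

/-- For the best receiver the cost splits into the dispersions of `x_t` over the histories. -/
theorem policyCost_eq_sum_dispersion (η : Policy d M) {X : ℕ → Ω → E d}
    (hX : ∀ t, Measurable (X t)) : policyCost P X T η =
      ∑ t ∈ Finset.range T, ∑ h : Fin (t + 1) → Fin M, (T : ℝ≥0∞)⁻¹ *
        dispersion ((P.restrict (η.history X (t + 1) ⁻¹' {h})).map (X t)) := by
  have hm : ∀ t, Measurable (η.history X t) := fun t => η.measurable_history t fun s _ => hX s
  let a : (t : ℕ) → (Fin (t + 1) → Fin M) → E d → ℝ≥0∞ := fun t h u =>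
    (T : ℝ≥0∞)⁻¹ * ∫⁻ ω in η.history X (t + 1) ⁻¹' {h}, ENNReal.ofReal (‖X t ω - u‖ ^ 2) ∂P
  have htot : ∀ γ : Receiver d M, totalCost P X T η γ =
      ∑ t ∈ Finset.range T, ∑ h, a t h (γ t h) := by
    intro γ
    have hγ : ∀ t, Measurable fun ω => ENNReal.ofReal
        (‖X t ω - γ t (η.history X (t + 1) ω)‖ ^ 2) := fun t => by
      have h1 : Measurable fun ω => γ t (η.history X (t + 1) ω) :=
        (measurable_of_countable (γ t)).comp (hm _)
      have := hX t
      fun_prop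
    rw [totalCost, lintegral_const_mul _ (Finset.measurable_sum _ fun t _ => hγ t),
      lintegral_finsetSum _ fun t _ => hγ t, Finset.mul_sum]
    refine Finset.sum_congr rfl fun t _ => ?_
    have hU : (⋃ h, η.history X (t + 1) ⁻¹' {h}) = Set.univ := by ext; simp
    rw [← setLIntegral_univ, ← hU, lintegral_iUnion (fun h => hm _ (measurableSet_singleton h))
      (fun i j hij => (Set.disjoint_singleton.2 hij).preimage _), tsum_fintype, Finset.mul_sum]
    refine Finset.sum_congr rfl fun h _ => ?_
    simp only [a]
    congr 1
    refine setLIntegral_congr_fun (hm _ (measurableSet_singleton h)) fun ω hω => ?_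
    have hω' : η.history X (t + 1) ω = h := hω
    simp only [hω']
  have hinf : ∀ t < T, ∀ h, ⨅ u, a t h u = (T : ℝ≥0∞)⁻¹ *
      dispersion ((P.restrict (η.history X (t + 1) ⁻¹' {h})).map (X t)) := by
    intro t ht h
    have hT : (T : ℝ≥0∞)⁻¹ ≠ ∞ := ENNReal.inv_ne_top.2 (by exact_mod_cast (by omega : T ≠ 0))
    rw [dispersion, ENNReal.mul_iInf fun h => absurd h hT]
    refine iInf_congr fun u => ?_
    rw [lintegral_map (by fun_prop) (hX t)]
  classical
  -- any two receivers are dominated by the receiver that takes the better estimate pointwise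
  have hdir : ∀ γ γ' : Receiver d M, ∃ γ'' : Receiver d M, ∀ t h,
      a t h (γ'' t h) ≤ a t h (γ t h) ∧ a t h (γ'' t h) ≤ a t h (γ' t h) := fun γ γ' => by
    refine ⟨fun t h => if a t h (γ t h) ≤ a t h (γ' t h) then γ t h else γ' t h, fun t h => ?_⟩
    beta_reduce
    split_ifs with hc
    · exact ⟨le_rfl, hc⟩
    · exact ⟨(not_le.1 hc).le, le_rfl⟩
  rw [policyCost]
  simp only [htot]
  rw [ENNReal.iInf_sum (f := fun (γ : Receiver d M) t => ∑ h, a t h (γ t h)) fun _ γ γ' =>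
    (hdir γ γ').imp fun γ'' H t _ =>
    ⟨Finset.sum_le_sum fun h _ => (H t h).1, Finset.sum_le_sum fun h _ => (H t h).2⟩]
  refine Finset.sum_congr rfl fun t ht => ?_
  rw [ENNReal.iInf_sum (f := fun (γ : Receiver d M) h => a t h (γ t h)) fun _ γ γ' => (hdir γ γ').imp fun γ'' H h _ => H t h]
  refine Finset.sum_congr rfl fun h _ => ?_
  rw [← hinf t (Finset.mem_range.1 ht)]
  have hsurj : Function.Surjective fun γ : Receiver d M => γ t h := fun u =>
    ⟨fun _ _ => u, rfl⟩
  exact hsurj.iInf_comp (a t h)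

theorem Policy.Follows.policyCost_eq {η : Policy d M} {X : ℕ → Ω → E d}
    {q : (t : ℕ) → (Fin t → Fin M) → Quantizer d M} (hq : η.Follows P X q)
    (hX : ∀ t, Measurable (X t)) : policyCost P X T η =
      ∑ t ∈ Finset.range T, ∑ h, (T : ℝ≥0∞)⁻¹ * stageCost (η.branchLaw P X t h) (q t h) := by
  rw [policyCost_eq_sum_dispersion η hX]
  refine Finset.sum_congr rfl fun t _ => ?_
  simp only [hq.map_restrict hX, stageCost_eq_sum_dispersion, Finset.mul_sum]
  exact sum_histories_succ fun h m =>
    (T : ℝ≥0∞)⁻¹ * dispersion ((η.branchLaw P X t h).restrict (cell (q t h) m))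

theorem Policy.isFiniteMeasure_branchLaw [IsProbabilityMeasure P] (η : Policy d M) (X : ℕ → Ω → E d) (t : ℕ)
    (h : Fin t → Fin M) : IsFiniteMeasure (η.branchLaw P X t h) := by
  unfold Policy.branchLaw; infer_instance

/-- Summed over the histories, the dynamic programming bracket is the present cost plus the value
of the next laws. -/
theorem Policy.Follows.sum_stepCost [IsProbabilityMeasure P] {η : Policy d M} (hM : 0 < M) [SFinite ν]
    (hs : IsSource P f X₀ W π₀ ν) {q : (t : ℕ) → (Fin t → Fin M) → Quantizer d M}
    (hq : η.Follows P (source f X₀ W) q) (k t : ℕ) :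
    ∑ h, stepCost f ν T k (η.branchLaw P (source f X₀ W) t h) (q t h) =
      ∑ h, (T : ℝ≥0∞)⁻¹ * stageCost (η.branchLaw P (source f X₀ W) t h) (q t h) +
      ∑ h, valueToGo M f ν T k (η.branchLaw P (source f X₀ W) (t + 1) h) := by
  have := η.isFiniteMeasure_branchLaw (P := P) (source f X₀ W) t
  simp only [stepCost, Finset.sum_add_distrib, expectedNext_eq hM, hq.branchLaw_succ hs]
  congr 1
  exact (sum_histories_succ fun h m => valueToGo M f ν T k
    (push f ν ((η.branchLaw P (source f X₀ W) t h).restrict (cell (q t h) m)))).symm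

/-- The value function bounds the cost of every policy that uses convex cells. -/
theorem Policy.Follows.valueToGo_le_policyCost [IsProbabilityMeasure P] {η : Policy d M} (hM : 0 < M) [SFinite ν]
    (hs : IsSource P f X₀ W π₀ ν) {q : (t : ℕ) → (Fin t → Fin M) → Quantizer d M}
    (hq : η.Follows P (source f X₀ W) q) (hconv : ∀ t h, q t h ∈ convexQuantizers d M) :
    valueToGo M f ν T T π₀ ≤ policyCost P (source f X₀ W) T η := by
  have key : ∀ n ≤ T, valueToGo M f ν T T π₀ ≤
      ∑ t ∈ Finset.range n, ∑ h, (T : ℝ≥0∞)⁻¹ *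
        stageCost (η.branchLaw P (source f X₀ W) t h) (q t h) +
      ∑ h, valueToGo M f ν T (T - n) (η.branchLaw P (source f X₀ W) n h) := by
    intro n
    induction n with
    | zero => intro _; simp [η.branchLaw_zero hs]
    | succ n ih =>
      intro hn
      refine (ih (by omega)).trans ?_
      rw [Finset.sum_range_succ, add_assoc, ← hq.sum_stepCost hM hs]
      obtain ⟨k, hk⟩ : ∃ k, T - n = k + 1 := ⟨T - n - 1, by omega⟩
      have hk' : T - (n + 1) = k := by omega
      rw [hk, hk']
      gcongr with h
      exact iInf₂_le _ (hconv n h)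
  have := key T le_rfl
  rw [Nat.sub_self] at this
  simpa [valueToGo, hq.policyCost_eq hs.measurable_source] using this

/-- A policy whose quantizers attain the infimum in the recursion has the optimal cost. -/
theorem Policy.Follows.policyCost_eq_valueToGo [IsProbabilityMeasure P] {η : Policy d M} (hM : 0 < M) [SFinite ν]
    (hs : IsSource P f X₀ W π₀ ν) {q : (t : ℕ) → (Fin t → Fin M) → Quantizer d M}
    (hq : η.Follows P (source f X₀ W) q)
    (hopt : ∀ t < T, ∀ h, stepCost f ν T (T - (t + 1)) (η.branchLaw P (source f X₀ W) t h) (q t h)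
      = valueToGo M f ν T (T - t) (η.branchLaw P (source f X₀ W) t h)) :
    policyCost P (source f X₀ W) T η = valueToGo M f ν T T π₀ := by
  have key : ∀ n ≤ T, valueToGo M f ν T T π₀ =
      ∑ t ∈ Finset.range n, ∑ h, (T : ℝ≥0∞)⁻¹ *
        stageCost (η.branchLaw P (source f X₀ W) t h) (q t h) +
      ∑ h, valueToGo M f ν T (T - n) (η.branchLaw P (source f X₀ W) n h) := by
    intro n
    induction n with
    | zero => intro _; simp [η.branchLaw_zero hs]
    | succ n ih =>
      intro hn
      rw [ih (by omega), Finset.sum_range_succ, add_assoc, ← hq.sum_stepCost hM hs]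
      congr 1
      exact Finset.sum_congr rfl fun h _ => (hopt n (by omega) h).symm
  have := key T le_rfl
  rw [Nat.sub_self] at this
  simpa [valueToGo, hq.policyCost_eq hs.measurable_source] using this.symm

end Branches

/-! ### Policies driven by the conditional law -/

section BeliefPolicies

variable {d M : ℕ} {Ω : Type*} [mΩ : MeasurableSpace Ω] {P : Measure Ω}
  {f : E d → E d → E d} {X₀ : Ω → E d} {W : ℕ → Ω → E d} {π₀ ν : Measure (E d)} {T : ℕ}

/-- The measure rescaled to total mass one (and `0` for the zero measure). -/
noncomputable def normalize (μ : Measure (E d)) : Measure (E d) := (μ Set.univ)⁻¹ • μ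

theorem normalize_of_isProbabilityMeasure (μ : Measure (E d)) [IsProbabilityMeasure μ] :
    normalize μ = μ := by
  simp [normalize]

theorem measure_univ_smul_normalize (μ : Measure (E d)) [IsFiniteMeasure μ] :
    μ Set.univ • normalize μ = μ := by
  rcases eq_or_ne (μ Set.univ) 0 with h | h
  · rw [h, zero_smul, Measure.measure_univ_eq_zero.1 h]
  · rw [normalize, smul_smul, ENNReal.mul_inv_cancel h (measure_ne_top _ _), one_smul]

/-- The unnormalised conditional law after the messages `h`, when at each time `t` the quantizer is
`sel t` evaluated at the normalised conditional law. It is computed without reference to a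
probability space, so that it can be used to define the encoders. -/
noncomputable def predictedLaw (f : E d → E d → E d) (π₀ ν : Measure (E d))
    (sel : ℕ → Measure (E d) → Quantizer d M) : (t : ℕ) → (Fin t → Fin M) → Measure (E d)
  | 0, _ => π₀
  | t + 1, h => push f ν ((predictedLaw f π₀ ν sel t (Fin.init h)).restrict
      (cell (sel t (normalize (predictedLaw f π₀ ν sel t (Fin.init h)))) (h (Fin.last t))))

/-- The policy that encodes at time `t` with the quantizer selected by the current conditional
law. -/
noncomputable def beliefPolicy (f : E d → E d → E d) (π₀ ν : Measure (E d))
    (sel : ℕ → Measure (E d) → Quantizer d M) : Policy d M where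
  enc t p := (sel t (normalize (predictedLaw f π₀ ν sel t p.1))).1 (p.2 (Fin.last t))
  measurable_enc t := measurable_from_prod_countable_right fun h =>
    (sel t (normalize (predictedLaw f π₀ ν sel t h))).2.comp (measurable_pi_apply _)

theorem beliefPolicy_follows (sel : ℕ → Measure (E d) → Quantizer d M) (X : ℕ → Ω → E d) :
    (beliefPolicy f π₀ ν sel).Follows P X
      fun t h => sel t (normalize (predictedLaw f π₀ ν sel t h)) := fun t =>
  Eventually.of_forall fun ω => by rw [Policy.message]; rfl

theorem branchLaw_beliefPolicy [IsProbabilityMeasure P] (hs : IsSource P f X₀ W π₀ ν)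
    (sel : ℕ → Measure (E d) → Quantizer d M) (t : ℕ) (h : Fin t → Fin M) :
    (beliefPolicy f π₀ ν sel).branchLaw P (source f X₀ W) t h = predictedLaw f π₀ ν sel t h := by
  induction t with
  | zero => exact Policy.branchLaw_zero _ hs h
  | succ t ih => rw [(beliefPolicy_follows sel _).branchLaw_succ hs, ih, predictedLaw]

/-- Almost surely the conditional law of `x_t` given the messages is the normalised law on the
branch of the observed history. -/
theorem Policy.belief_eq_normalize [IsProbabilityMeasure P] (η : Policy d M) {X : ℕ → Ω → E d}
    (hX : ∀ t, Measurable (X t)) (t : ℕ) : ∀ᵐ ω ∂P,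
      (η.belief P X t ω : Measure (E d)) = normalize (η.branchLaw P X t (η.history X t ω)) := by
  have hm : Measurable (η.history X t) := η.measurable_history t fun s _ => hX s
  have hpos : ∀ᵐ ω ∂P, ∀ h, P (η.history X t ⁻¹' {h}) = 0 → η.history X t ω ≠ h :=
    ae_all_iff.2 fun h => by
      by_cases h0 : P (η.history X t ⁻¹' {h}) = 0
      · filter_upwards [measure_eq_zero_iff_ae_notMem.1 h0] with ω hω _ using hω
      · exact Eventually.of_forall fun ω h1 => absurd h1 h0
  filter_upwards [hpos] with ω hω
  set h := η.history X t ω with hh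
  have hne : P (η.history X t ⁻¹' {h}) ≠ 0 := fun h0 => hω h h0 rfl
  have hmap : P.map (η.history X t) {h} = P (η.history X t ⁻¹' {h}) :=
    Measure.map_apply hm (measurableSet_singleton h)
  change condDistrib (X t) (η.history X t) P h = _
  ext s hset
  rw [condDistrib_apply_of_ne_zero (hX t) h (by rwa [hmap]), hmap, normalize, Policy.branchLaw,
    Measure.smul_apply, smul_eq_mul, Measure.map_apply (hX t) hset,
    Measure.map_apply (hX t) MeasurableSet.univ, Set.preimage_univ, Measure.restrict_apply_univ,
    Measure.restrict_apply (hX t hset), Measure.map_apply (hm.prodMk (hX t))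
      ((measurableSet_singleton h).prod hset)]
  congr 2
  ext ω'
  simp only [Set.mem_inter_iff, Set.mem_preimage, Set.mem_prod]
  tauto

theorem beliefPolicy_mem_convexMarkovPolicies [IsProbabilityMeasure P]
    (hs : IsSource P f X₀ W π₀ ν) (sel : ℕ → Measure (E d) → Quantizer d M)
    (hsel : ∀ t μ, sel t μ ∈ convexQuantizers d M) :
    beliefPolicy f π₀ ν sel ∈ convexMarkovPolicies M P (source f X₀ W) := by
  refine ⟨fun t μ => sel t μ, fun t μ => hsel t μ, fun t => ?_⟩
  filter_upwards [beliefPolicy_follows sel (source f X₀ W) t,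
    (beliefPolicy f π₀ ν sel).belief_eq_normalize hs.measurable_source t] with ω h1 h2
  rw [h1, h2, branchLaw_beliefPolicy hs]

theorem valueToGo_le_policyCost_of_mem [IsProbabilityMeasure P] (hM : 0 < M) [SFinite ν]
    (hs : IsSource P f X₀ W π₀ ν) {η : Policy d M}
    (hη : η ∈ convexMarkovPolicies M P (source f X₀ W)) :
    valueToGo M f ν T T π₀ ≤ policyCost P (source f X₀ W) T η := by
  obtain ⟨sel, hconv, hsel⟩ := hη
  refine Policy.Follows.valueToGo_le_policyCost hM hs (q := fun t h => sel t
    ⟨condDistrib (source f X₀ W t) (η.history (source f X₀ W) t) P h, inferInstance⟩)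
    hsel fun t h => hconv _ _

/-- Selecting an optimal quantizer for each conditional law gives a policy whose cost is the value
function at the initial law. -/
theorem exists_optimal_policy [IsProbabilityMeasure P] [IsProbabilityMeasure π₀] (hM : 0 < M)
    (hT : 1 ≤ T) (hd : RegularDynamics f ν) (hs : IsSource P f X₀ W π₀ ν)
    (hmom : HasFiniteMoments π₀)
    (hopt : ∃ Q ∈ convexQuantizers d M,
      stepCost f ν T (T - 1) π₀ Q = valueToGo M f ν T (T - 1 + 1) π₀) :
    ∃ η ∈ convexMarkovPolicies M P (source f X₀ W),
      policyCost P (source f X₀ W) T η = valueToGo M f ν T T π₀ := by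
  have := hd.isProbabilityMeasure
  have hsel : ∀ (t : ℕ) (μ : Measure (E d)), ∃ Q ∈ convexQuantizers d M,
      (∃ Q' ∈ convexQuantizers d M, stepCost f ν T (T - (t + 1)) μ Q' =
        valueToGo M f ν T (T - (t + 1) + 1) μ) →
      stepCost f ν T (T - (t + 1)) μ Q = valueToGo M f ν T (T - (t + 1) + 1) μ := by
    intro t μ
    by_cases h : ∃ Q' ∈ convexQuantizers d M, stepCost f ν T (T - (t + 1)) μ Q' =
        valueToGo M f ν T (T - (t + 1) + 1) μ
    · obtain ⟨Q, hQ, hQ'⟩ := h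
      exact ⟨Q, hQ, fun _ => hQ'⟩
    · obtain ⟨Q, hQ⟩ := convexQuantizers_nonempty (d := d) hM
      exact ⟨Q, hQ, fun h' => absurd h' h⟩
  choose sel hsel_conv hsel_opt using hsel
  set η := beliefPolicy f π₀ ν sel
  have hfollows : η.Follows P (source f X₀ W) _ := beliefPolicy_follows sel _
  refine ⟨η, beliefPolicy_mem_convexMarkovPolicies hs sel hsel_conv,
    hfollows.policyCost_eq_valueToGo hM hs fun t ht h => ?_⟩
  have hfin := η.isFiniteMeasure_branchLaw (P := P) (source f X₀ W) t h
  rw [← branchLaw_beliefPolicy hs sel t h]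
  change stepCost f ν T _ (η.branchLaw P (source f X₀ W) t h)
    (sel t (normalize (η.branchLaw P (source f X₀ W) t h))) = _
  have hkt : T - t = T - (t + 1) + 1 := by omega
  rw [hkt]
  set β := η.branchLaw P (source f X₀ W) t h with hβ
  -- the zero measure has value zero; otherwise `normalize β` has an optimal quantizer
  have hN : β Set.univ ≠ 0 → ∃ Q ∈ convexQuantizers d M,
      stepCost f ν T (T - (t + 1)) (normalize β) Q =
        valueToGo M f ν T (T - (t + 1) + 1) (normalize β) := by
    intro hβ0
    have hall : ∀ (s : ℕ) (g : Fin s → Fin M),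
        HasFiniteMoments (η.branchLaw P (source f X₀ W) s g) := by
      intro s
      induction s with
      | zero => intro g; rw [η.branchLaw_zero hs]; exact hmom
      | succ s ih =>
        intro g
        rw [hfollows.branchLaw_succ hs]
        exact hd.hasFiniteMoments_push ((ih _).restrict _)
    cases t with
    | zero =>
      have h0 : β = π₀ := η.branchLaw_zero hs h
      rw [h0, normalize_of_isProbabilityMeasure]
      exact hopt
    | succ t =>
      refine exists_optimal_quantizer hM hT hd _
        ((hall _ h).smul (ENNReal.inv_ne_top.2 hβ0)) ?_
      refine Measure.smul_absolutelyContinuous.trans ?_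
      rw [hβ, hfollows.branchLaw_succ hs]
      have := η.isFiniteMeasure_branchLaw (P := P) (source f X₀ W) t (Fin.init h)
      exact hd.push_absolutelyContinuous _
  rw [← measure_univ_smul_normalize β, stepCost_smul _ _ _ (measure_ne_top _ _),
    valueToGo_smul hM _ _ (measure_ne_top _ _), measure_univ_smul_normalize β]
  rcases eq_or_ne (β Set.univ) 0 with h0 | h0
  · rw [h0, zero_mul, zero_mul]
  · rw [hsel_opt t _ (hN h0)]

end BeliefPolicies

end ZeroDelay

theorem theorem5 {d M : ℕ} (hM : 0 < M) {Ω : Type*} [MeasurableSpace Ω]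
    (P : Measure Ω) [IsProbabilityMeasure P]
    -- the source: initial state `X₀` with law `π₀`, i.i.d. noise `W` with law `ν`, dynamics `f`
    (f : E d → E d → E d) (hf : Measurable (Function.uncurry f))
    (X₀ : Ω → E d) (W : ℕ → Ω → E d) (hX₀ : Measurable X₀) (hW : ∀ t, Measurable (W t))
    (π₀ : ProbabilityMeasure (E d)) (ν : Measure (E d)) [IsProbabilityMeasure ν]
    (hX₀_law : P.map X₀ = (π₀ : Measure (E d))) (hW_law : ∀ t, P.map (W t) = ν)
    (hW_indep : iIndepFun W P) (hX₀_indep : IndepFun X₀ (fun ω t => W t ω) P)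
    -- `f (x, w)` has a positive density, bounded and Lipschitz uniformly in `x`
    (φ : E d → E d → ℝ) (C : ℝ) (C₁ : ℝ≥0)
    (hφ : ∀ x, ν.map (f x) = volume.withDensity (fun z => ENNReal.ofReal (φ x z)))
    (hφ_pos : ∀ x z, 0 < φ x z) (hφ_le : ∀ x z, φ x z ≤ C)
    (hφ_lip : ∀ x, LipschitzWith C₁ (φ x))
    -- linear growth, noise with finite second moment, and the condition on the initial law
    (K : ℝ) (hK : 0 < K) (hgrowth : ∀ x w, ‖f x w‖ ≤ K * (‖x‖ + ‖w‖))
    (hν : secondMoment ν < ∞)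
    (hπ₀ : ((∃ ρ : E d → ℝ≥0∞, Measurable ρ ∧ (π₀ : Measure (E d)) = volume.withDensity ρ) ∧
        secondMoment (π₀ : Measure (E d)) < ∞) ∨
      ∃ x₀ : E d, (π₀ : Measure (E d)) = Measure.dirac x₀)
    (T : ℕ) (hT : 1 ≤ T) :
    -- there is an optimal policy
    (∃ η ∈ convexMarkovPolicies M P (source f X₀ W),
      policyCost P (source f X₀ W) T η =
        ⨅ η' ∈ convexMarkovPolicies M P (source f X₀ W), policyCost P (source f X₀ W) T η') ∧
    -- the minimal cost is the (finite) value given by dynamic programming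
    IsLeast (policyCost P (source f X₀ W) T '' convexMarkovPolicies M P (source f X₀ W))
      (valueFn M f ν T 0 π₀) ∧
    valueFn M f ν T 0 π₀ < ∞ ∧
    -- the dynamic programming recursion holds, with the minimum attained
    (∀ π : ProbabilityMeasure (E d), valueFn M f ν T T π = 0) ∧
    (∀ t < T, ∀ π : ProbabilityMeasure (E d), (π ∈ smoothLaws d C C₁ ∨ (t = 0 ∧ π = π₀)) →
      IsLeast ((fun Q : Quantizer d M => (T : ℝ≥0∞)⁻¹ * stageCost (π : Measure (E d)) Q +
          expectedNext f ν (valueFn M f ν T (t + 1)) π Q) '' convexQuantizers d M)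
        (valueFn M f ν T t π)) ∧
    -- the value functions are continuous along convergent, uniformly integrable sequences
    (∀ t < T, ∀ (μ : ℕ → ProbabilityMeasure (E d)) (π : ProbabilityMeasure (E d)),
      (∀ n, μ n ∈ smoothLaws d C C₁) → π ∈ smoothLaws d C C₁ → Tendsto μ atTop (𝓝 π) →
      UnifIntegrableSq μ →
      valueFn M f ν T t π < ∞ ∧
      Tendsto (fun n => valueFn M f ν T t (μ n : Measure (E d))) atTop
        (𝓝 (valueFn M f ν T t π))) := by
  have hd : RegularDynamics f ν :=
    { measurable := hf
      growth := ⟨K, hK, hgrowth⟩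
      isProbabilityMeasure := inferInstance
      secondMoment_lt_top := hν
      absolutelyContinuous := fun x => by
        rw [hφ x]; exact withDensity_absolutelyContinuous _ _ }
  have hs : IsSource P f X₀ W (π₀ : Measure (E d)) ν :=
    ⟨hf, hX₀, hW, hX₀_law, hW_law, hW_indep, hX₀_indep⟩
  have hmom : HasFiniteMoments (π₀ : Measure (E d)) := by
    refine ⟨inferInstance, ?_⟩
    rcases hπ₀ with ⟨-, h⟩ | ⟨x₀, h⟩
    · exact h
    · rw [h, secondMoment, lintegral_dirac]
      exact ENNReal.ofReal_lt_top
  have hopt₀ : ∀ k, ∃ Q ∈ convexQuantizers d M, stepCost f ν T k (π₀ : Measure (E d)) Q =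
      valueToGo M f ν T (k + 1) π₀ := by
    intro k
    rcases hπ₀ with ⟨⟨ρ, -, h⟩, -⟩ | ⟨x₀, h⟩
    · exact exists_optimal_quantizer hM hT hd k hmom
        (by rw [h]; exact withDensity_absolutelyContinuous _ _)
    · rw [h]
      exact exists_optimal_quantizer_dirac hM k x₀
  obtain ⟨η, hη, hcost⟩ := exists_optimal_policy hM hT hd hs hmom (hopt₀ _)
  have hleast : IsLeast (policyCost P (source f X₀ W) T ''
      convexMarkovPolicies M P (source f X₀ W)) (valueFn M f ν T 0 π₀) := by
    refine ⟨⟨η, hη, hcost⟩, ?_⟩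
    rintro _ ⟨η', hη', rfl⟩
    exact valueToGo_le_policyCost_of_mem hM hs hη'
  refine ⟨⟨η, hη, ?_⟩, hleast, valueToGo_lt_top hM hT hd T hmom, ?_, ?_, ?_⟩
  · refine le_antisymm (le_iInf₂ fun η' hη' => ?_) (iInf₂_le η hη)
    rw [hcost]
    exact valueToGo_le_policyCost_of_mem hM hs hη'
  · intro π
    rw [valueFn, Nat.sub_self]
    rfl
  · intro t ht π hπ
    have hk : T - t = T - (t + 1) + 1 := by omega
    obtain ⟨Q, hQ, hQopt⟩ : ∃ Q ∈ convexQuantizers d M,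
        stepCost f ν T (T - (t + 1)) (π : Measure (E d)) Q =
          valueToGo M f ν T (T - (t + 1) + 1) π := by
      rcases hπ with hπ | ⟨-, rfl⟩
      · rcases eq_or_ne (secondMoment (π : Measure (E d))) ∞ with h | h
        · exact exists_optimal_quantizer_of_secondMoment_eq_top hM _ h
        · exact exists_optimal_quantizer hM hT hd _ ⟨inferInstance, h.lt_top⟩
            (absolutelyContinuous_of_mem_smoothLaws hπ)
      · exact hopt₀ _
    simp only [valueFn, hk]
    refine ⟨⟨Q, hQ, hQopt⟩, ?_⟩
    rintro _ ⟨Q', hQ', rfl⟩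
    exact iInf₂_le Q' hQ'
  · intro t ht μ π hμ hπ hconv hUI
    obtain ⟨h1, h2, h3⟩ := weightedConv_of_mem_smoothLaws hμ hπ hconv hUI
    exact ⟨valueToGo_lt_top hM hT hd _ h2, tendsto_valueToGo hM hT hd _ _ _ h1
      (fun n => absolutelyContinuous_of_mem_smoothLaws (hμ n)) h2
      (absolutelyContinuous_of_mem_smoothLaws hπ) h3⟩
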